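/- Setting. Fix a signature consisting of constants (among them a distinct constant for each integer), predicate symbols with arities, and aggregate function symbols $aggr$, each with a fixed interpretation mapping finite sets and finite multisets of constants to $\mathbb Z$; symbols are written as binary words, injectively for each kind of symbol. A ground program $P$ is a finite collection of rules $A \leftarrow C_1,\dots,C_m,A_1,\dots,A_n,\mathit{not}\,B_1,\dots,\mathit{not}\,B_k$ over a finite set of constants and a finite set of predicate symbols, with Herbrand base $\mathcal B_P$; here $A,A_i,B_j$ are ground atoms and the $C_i$ are ground aggregate atoms $aggr(s)\ \mathtt{op}\ v$ with $\mathtt{op}\in\{=,\neq,<,>,\leq,\geq\}$, $v\in\mathbb Z$, and $s$ an intensional set $\{X\mid p(\dots)\}$ or an intensional multiset $\{\!\{X\mid \exists \bar Z.\,p(\dots)\}\!\}$. An interpretation is a subset of $\mathcal B_P$, and $I\models aggr(s)\ \mathtt{op}\ v$ means that the value of $aggr$ on the (multi)set of values of $X$ collected in $I$ stands in relation $\mathtt{op}$ to $v$. For an aggregate atom $\ell$ let $\mathcal H(\ell)\subseteq\mathcal B_P$ be the set of atoms with the predicate $p$ of $\ell$. A pair $\langle S_1,S_2\rangle$ of disjoint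 subsets of $\mathcal H(\ell)$ is a solution of $\ell$ if $I\models\ell$ for every interpretation $I$ with $S_1\subseteq I$ and $S_2\cap I=\emptyset$. For interpretations $I,M$ put $$K^P_M(I)=\{\,head(r)\mid r\in P,\ neg(r)\cap M=\emptyset,\ pos(r)\subseteq I,\ \langle I\cap M\cap\mathcal H(\ell),\ \mathcal H(\ell)\setminus M\rangle\text{ is a solution of }\ell\text{ for every }\ell\in agg(r)\,\}.$$ $M$ is a fixpoint answer set of $P$ if $M$ is the least fixpoint of $K^P_M$ in $2^{\mathcal B_P}$. Let $C$ be a class of languages over $\{0,1\}$. $\mathbf{NP}^C$ is the union over $A\in C$ of the classes $\mathbf{NP}^A$ of languages that have certificates of polynomial length which are verifiable in deterministic polynomial time with oracle $A$; $\mathbf{co\text{-}NP}^C$ is the class of the complements of the languages in $\mathbf{NP}^C$. A set $\mathcal A$ of ground aggregate atoms is $C$-decidable if there is a language in $C$ that decides, for every given $\ell\in\mathcal A$ and every given interpretation $M$ (a finite set of atoms, listed without repetition), whether $M\models\ell$. Theorem. Let $\mathcal A$ be a $C$-decidable set of ground aggregate atoms. Then the answer set checking problem for programs with aggregate atoms in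 $\mathcal A$ (given a ground program $P$ all of whose aggregate atoms belong to $\mathcal A$ and an interpretation $M$ of $P$, determine whether $M$ is a fixpoint answer set of $P$) is in $\mathbf{co\text{-}NP}^C$: there is a language in $\mathbf{co\text{-}NP}^C$ that contains the encoding of such an instance $(P,M)$ if and only if $M$ is a fixpoint answer set of $P$. -/

import Mathlib

/-! ## Words, oracle machines, and the classes `P^A`, `NP^A`, `coNP^C` -/

/-- Self-delimiting binary encoding of a finite sequence of words: every bit `b` of an item is
written `1b`, and the end of an item is written `0`. -/
def encWords (l : List (List Bool)) : List Bool :=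
  l.flatMap fun w => (w.flatMap fun b => [true, b]) ++ [false]

/-- The elementary operations of an oracle machine with stacks (half-tapes) indexed by `K` and
control states `Λ`. -/
inductive OracleInstr (K Λ : Type) : Type
  /-- push a bit on a stack and go to a state -/
  | push (k : K) (b : Bool) (next : Λ)
  /-- remove the top bit of a stack and branch on it (`none`: the stack was empty) -/
  | pop (k : K) (next : Option Bool → Λ)
  /-- ask the oracle whether the word on a stack, read from the top, belongs to it, and branch -/
  | query (k : K) (next : Bool → Λ)
  /-- stop with a verdict -/
  | halt (verdict : Bool)

/-- A deterministic oracle Turing machine, in its multi-stack form (a tape is a pair of stacks):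
finitely many stacks over the binary alphabet, finitely many control states, one elementary
operation for each state. -/
structure OracleMachine where
  K : Type
  [decEqK : DecidableEq K]
  [fintypeK : Fintype K]
  Λ : Type
  [fintypeΛ : Fintype Λ]
  input : K
  start : Λ
  instr : Λ → OracleInstr K Λ

attribute [instance] OracleMachine.decEqK OracleMachine.fintypeK OracleMachine.fintypeΛ

namespace OracleMachine

structure Cfg (T : OracleMachine) where
  state : T.Λ
  stk : T.K → List Bool

open Classical in
/-- One computation step with oracle `A`; a halted configuration does not change. -/
noncomputable def step (T : OracleMachine) (A : Language Bool) (c : T.Cfg) : T.Cfg :=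
  match T.instr c.state with
  | .push k b next => ⟨next, Function.update c.stk k (b :: c.stk k)⟩
  | .pop k next => ⟨next (c.stk k).head?, Function.update c.stk k (c.stk k).tail⟩
  | .query k next => ⟨next (decide (c.stk k ∈ A)), c.stk⟩
  | .halt _ => c

/-- The verdict of a configuration, if it is a halted one. -/
def verdict (T : OracleMachine) (c : T.Cfg) : Option Bool :=
  match T.instr c.state with
  | .halt b => some b
  | _ => none

/-- The initial configuration: the input word on the input stack, all other stacks empty. -/
def init (T : OracleMachine) (w : List Bool) : T.Cfg :=
  ⟨T.start, Function.update (fun _ => []) T.input w⟩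

/-- With oracle `A`, started on `w`, the machine halts with verdict `b` within `t` steps. -/
def HaltsIn (T : OracleMachine) (A : Language Bool) (w : List Bool) (t : ℕ) (b : Bool) : Prop :=
  T.verdict ((T.step A)^[t] (T.init w)) = some b

end OracleMachine

/-- `P^A`: languages decided by a deterministic oracle machine with oracle `A` in polynomially
many steps. -/
def PRel (A : Language Bool) : Set (Language Bool) :=
  {L | ∃ (T : OracleMachine) (p : Polynomial ℕ), ∀ w : List Bool,
    ∃ b : Bool, T.HaltsIn A w (p.eval w.length) b ∧ (b = true ↔ w ∈ L)}

/-- `NP^A`: languages with certificates of polynomial length that are verifiable in `P^A`. -/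
def NPRel (A : Language Bool) : Set (Language Bool) :=
  {L | ∃ V ∈ PRel A, ∃ q : Polynomial ℕ, ∀ w : List Bool,
    w ∈ L ↔ ∃ y : List Bool, y.length ≤ q.eval w.length ∧ encWords [w, y] ∈ V}

/-- `NP^C`, the union of `NP^A` over the oracles `A` in `C`. -/
def NPClass (C : Set (Language Bool)) : Set (Language Bool) :=
  {L | ∃ A ∈ C, L ∈ NPRel A}

/-- `co-NP^C`: the complements of the languages in `NP^C`. -/
def CoNPClass (C : Set (Language Bool)) : Set (Language Bool) :=
  {L | ∃ N ∈ NPClass C, ∀ w : List Bool, w ∈ L ↔ w ∉ N}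

/-! ## Ground logic programs with aggregates -/

/-- A signature: constants (with distinct constants for the integers), predicate symbols with
arities, and aggregate function symbols with their fixed interpretation, which maps a finite set
or a finite multiset of constants to an integer. The symbols are written down as binary words,
distinct symbols of the same kind as distinct words. -/
structure AspSignature where
  Const : Type
  int : ℤ → Const
  int_injective : Function.Injective int
  Pred : Type
  arity : Pred → ℕ
  Agg : Type
  aggInterp : Agg → Finset Const ⊕ Multiset Const → ℤ
  constName : Const → List Bool
  constName_injective : Function.Injective constName
  predName : Pred → List Bool
  predName_injective : Function.Injective predName
  aggName : Agg → List Bool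
  aggName_injective : Function.Injective aggName

namespace AspSignature

variable (S : AspSignature)

/-- Ground ASP-atoms `p(c₁,…,cₙ)`. -/
structure Atom where
  pred : S.Pred
  args : Fin (S.arity pred) → S.Const

/-- A pattern `p(Y₁,…,Yₘ)` each of whose arguments is a constant or one of the bound variables
with numbers `0, …, r`, each of which occurs. Number `0` is the grouped variable `X`, the numbers
`1, …, r` are the local variables `Z₁, …, Zᵣ`. -/
structure Pattern (r : ℕ) where
  pred : S.Pred
  args : Fin (S.arity pred) → S.Const ⊕ Fin (r + 1)
  occurs : ∀ j : Fin (r + 1), ∃ i, args i = Sum.inr j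

/-- Ground intensional sets `{X | p(…)}` and multisets `{{X | ∃ Z₁ … Zᵣ. p(…)}}`. -/
inductive IntensionalSet
  | set (p : S.Pattern 0)
  | multiset (r : ℕ) (p : S.Pattern r)

end AspSignature

/-- The relational operators of aggregate atoms. -/
inductive RelOp
  | eq | ne | lt | gt | le | ge

def RelOp.Holds : RelOp → ℤ → ℤ → Prop
  | .eq, a, b => a = b
  | .ne, a, b => a ≠ b
  | .lt, a, b => a < b
  | .gt, a, b => a > b
  | .le, a, b => a ≤ b
  | .ge, a, b => a ≥ b

def RelOp.name : RelOp → List Bool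
  | .eq => [false, false, false]
  | .ne => [false, false, true]
  | .lt => [false, true, false]
  | .gt => [false, true, true]
  | .le => [true, false, false]
  | .ge => [true, false, true]

namespace AspSignature

variable (S : AspSignature)

/-- Ground aggregate atoms `aggr(s) op result`. -/
structure AggAtom where
  aggr : S.Agg
  source : S.IntensionalSet
  op : RelOp
  result : ℤ

/-- Ground rules `head ← agg, pos, not neg`. -/
structure Rule where
  head : S.Atom
  agg : List S.AggAtom
  pos : List S.Atom
  neg : List S.Atom

/-- A (finite) program signature: the constants `F_P`, which form the Herbrand universe, and the
predicate symbols `Π_P`. -/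
structure ProgSig where
  consts : Finset S.Const
  preds : Finset S.Pred

variable {S}

/-- The Herbrand base `B_P`. An interpretation is a subset of it. -/
def ProgSig.base (σ : S.ProgSig) : Set S.Atom :=
  {a | a.pred ∈ σ.preds ∧ ∀ i, a.args i ∈ σ.consts}

/-- The ground instance of a pattern under a substitution of constants for its variables. -/
def Pattern.inst {r : ℕ} (p : S.Pattern r) (γ : Fin (r + 1) → S.Const) : S.Atom :=
  ⟨p.pred, fun i => Sum.elim id γ (p.args i)⟩

def Pattern.Over {r : ℕ} (p : S.Pattern r) (σ : S.ProgSig) : Prop :=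
  p.pred ∈ σ.preds ∧ ∀ i c, p.args i = Sum.inl c → c ∈ σ.consts

/-- The grouped predicate. -/
def IntensionalSet.pred : S.IntensionalSet → S.Pred
  | .set p => p.pred
  | .multiset _ p => p.pred

def IntensionalSet.Over (s : S.IntensionalSet) (σ : S.ProgSig) : Prop :=
  match s with
  | .set p => p.Over σ
  | .multiset _ p => p.Over σ

open Classical in
/-- The value of an intensional (multi)set in the interpretation `I`: the set of the constants
`a` with `p(…)[X/a]` true, respectively the multiset in which `a` is repeated once for each
substitution of the variables that maps `X` to `a` and makes `p(…)` true. -/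
noncomputable def IntensionalSet.value (σ : S.ProgSig) (I : Set S.Atom) :
    S.IntensionalSet → Finset S.Const ⊕ Multiset S.Const
  | .set p => Sum.inl (σ.consts.filter fun a => p.inst (fun _ => a) ∈ I)
  | .multiset r p => Sum.inr
      (((Fintype.piFinset fun _ : Fin (r + 1) => σ.consts).filter
        fun γ => p.inst γ ∈ I).val.map fun γ => γ 0)

/-- The aggregate atom belongs to the language of the program signature. -/
def AggAtom.Over (ℓ : S.AggAtom) (σ : S.ProgSig) : Prop :=
  ℓ.source.Over σ ∧ S.int ℓ.result ∈ σ.consts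

/-- `I ⊨ ℓ`. -/
def AggAtom.Sat (σ : S.ProgSig) (I : Set S.Atom) (ℓ : S.AggAtom) : Prop :=
  ℓ.op.Holds (S.aggInterp ℓ.aggr (ℓ.source.value σ I)) ℓ.result

/-- `H(ℓ)`: the atoms of the Herbrand base with the grouped predicate of `ℓ`. -/
def AggAtom.ext (σ : S.ProgSig) (ℓ : S.AggAtom) : Set S.Atom :=
  {a ∈ σ.base | a.pred = ℓ.source.pred}

/-- `⟨S₁, S₂⟩` is an aggregate solution of `ℓ`. -/
def AggAtom.IsSolution (σ : S.ProgSig) (ℓ : S.AggAtom) (S₁ S₂ : Set S.Atom) : Prop :=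
  S₁ ⊆ ℓ.ext σ ∧ S₂ ⊆ ℓ.ext σ ∧ Disjoint S₁ S₂ ∧
    ∀ I ⊆ σ.base, S₁ ⊆ I → S₂ ∩ I = ∅ → ℓ.Sat σ I

/-- Conditional satisfaction `(I, M) ⊨ ℓ` of an aggregate atom. -/
def AggAtom.CondSat (σ : S.ProgSig) (I M : Set S.Atom) (ℓ : S.AggAtom) : Prop :=
  ℓ.IsSolution σ (I ∩ M ∩ ℓ.ext σ) (ℓ.ext σ \ M)

def Rule.Over (r : S.Rule) (σ : S.ProgSig) : Prop :=
  r.head ∈ σ.base ∧ (∀ a ∈ r.pos, a ∈ σ.base) ∧ (∀ a ∈ r.neg, a ∈ σ.base) ∧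
    ∀ ℓ ∈ r.agg, ℓ.Over σ

variable (S)

/-- A ground program: a finite collection of ground rules over a finite program signature. -/
structure Program where
  sig : S.ProgSig
  rules : List S.Rule
  rules_over : ∀ r ∈ rules, r.Over sig

variable {S}

namespace Program

/-- The reduct of `P` with respect to `M`. -/
def reduct (P : S.Program) (M : Set S.Atom) : Set S.Rule :=
  {r' | ∃ r ∈ P.rules, (∀ b ∈ r.neg, b ∉ M) ∧ r' = ⟨r.head, r.agg, r.pos, []⟩}

/-- The consequence operator `K_M^P`. -/
def K (P : S.Program) (M I : Set S.Atom) : Set S.Atom :=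
  {a | ∃ r ∈ P.reduct M, (∀ b ∈ r.pos, b ∈ I) ∧ (∀ ℓ ∈ r.agg, ℓ.CondSat P.sig I M) ∧
    a = r.head}

/-- `M` is a fixpoint answer set of `P`: it is the least fixpoint of `K_M^P` among the
interpretations of `P`. -/
def IsFixpointAnswerSet (P : S.Program) (M : Set S.Atom) : Prop :=
  IsLeast {I : Set S.Atom | I ⊆ P.sig.base ∧ P.K M I = I} M

end Program

/-! ## Encodings and the decision problems -/

def Atom.enc (a : S.Atom) : List Bool :=
  encWords (S.predName a.pred :: List.ofFn fun i => S.constName (a.args i))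

/-- A finite set of atoms is written down by listing its elements. -/
def encAtoms (l : List S.Atom) : List Bool :=
  encWords (l.map Atom.enc)

def Pattern.enc {r : ℕ} (p : S.Pattern r) : List Bool :=
  encWords (S.predName p.pred :: List.ofFn fun i =>
    Sum.elim (fun c => true :: S.constName c) (fun j => false :: Nat.bits j) (p.args i))

def IntensionalSet.enc : S.IntensionalSet → List Bool
  | .set p => false :: p.enc
  | .multiset _ p => true :: p.enc

def AggAtom.enc (ℓ : S.AggAtom) : List Bool :=
  encWords [S.aggName ℓ.aggr, ℓ.source.enc, ℓ.op.name, S.constName (S.int ℓ.result)]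

def Rule.enc (r : S.Rule) : List Bool :=
  encWords [r.head.enc, encWords (r.agg.map AggAtom.enc), encAtoms r.pos, encAtoms r.neg]

/-- An instance of the answer set checking problem: the rules of `P` and the atoms of `M`. -/
def Program.encWith (P : S.Program) (M : List S.Atom) : List Bool :=
  encWords [encWords (P.rules.map Rule.enc), encAtoms M]

/-- The interpretation `M` of the program signature `σ` is given by the list `l`, which enumerates
its elements without repetition. -/
def Lists (σ : S.ProgSig) (l : List S.Atom) (M : Set S.Atom) : Prop :=
  M ⊆ σ.base ∧ l.Nodup ∧ ∀ a, a ∈ l ↔ a ∈ M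

/-- The aggregate atoms in `𝒜` are `C`-decidable: some oracle in `C` tells, for an aggregate atom
of `𝒜` and an interpretation, whether the atom is true in the interpretation. -/
def CDecidable (C : Set (Language Bool)) (𝒜 : Set S.AggAtom) : Prop :=
  ∃ A ∈ C, ∀ (σ : S.ProgSig) (ℓ : S.AggAtom), ℓ ∈ 𝒜 → ℓ.Over σ →
    ∀ (l : List S.Atom) (M : Set S.Atom), Lists σ l M →
      (encWords [ℓ.enc, encAtoms l] ∈ A ↔ ℓ.Sat σ M)

/-- All aggregate atoms that occur in `P` belong to `𝒜`. -/
def Program.AggregatesIn (P : S.Program) (𝒜 : Set S.AggAtom) : Prop :=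
  ∀ r ∈ P.rules, ∀ ℓ ∈ r.agg, ℓ ∈ 𝒜

/-- The language `L` solves the answer set checking problem for the programs with aggregate atoms
in `𝒜`: on each instance (a program with aggregate atoms in `𝒜` and an interpretation of it),
membership in `L` tells whether the interpretation is a fixpoint answer set. -/
def SolvesACP (𝒜 : Set S.AggAtom) (L : Language Bool) : Prop :=
  ∀ (P : S.Program), P.AggregatesIn 𝒜 → ∀ (l : List S.Atom) (M : Set S.Atom),
    Lists P.sig l M → (P.encWith l ∈ L ↔ P.IsFixpointAnswerSet M)

end AspSignature

/-!
Write `K` for `K_M^P`. It is monotone in `I`, since enlarging the positive part of a conditional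
solution leaves fewer interpretations to be tested. So `M` is *not* a fixpoint answer set iff `K M`
is not contained in `M`, or `K I ⊆ I` for some proper subset `I` of `M`. For `I ⊆ M`, an aggregate
atom fails to be conditionally satisfied iff it is false in some `J` with `I ⊆ J ⊆ M`, which is one
query to the oracle. Hence `I` together with one such `J` for every rule is a certificate, and it is
checked in polynomial time. The condition `K M ⊆ M` needs no certificate since only `J = M` is left.

The polynomial time bound is obtained by compiling structured stack programs to oracle machines.
Such a program computes a function by replacing the word on a given stack by its value, whatever the
number of the first scratch stack is; functions computable in this way are closed under composition,
pairing, case distinction and bounded iteration.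
-/

/-! ## Sequences of words -/

/-- Puts the item `x` in front of an encoded sequence of words. Since `headItem` and `tailItems`
undo this for arbitrary words `x` and `w`, it also serves as a pairing function on words. -/
def consItem : List Bool → List Bool → List Bool
  | [], w => false :: w
  | b :: x, w => true :: b :: consItem x w

/-- The first item of an encoded sequence of words, and what follows it. Every word is read as an
encoded sequence: an unfinished last item is closed by the end of the word. -/
def splitItem : List Bool → List Bool × List Bool
  | [] => ([], [])
  | [true] => ([], [])
  | false :: w => ([], w)
  | true :: b :: w => (b :: (splitItem w).1, (splitItem w).2)

/-- The first item of an encoded sequence of words. -/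
def headItem (w : List Bool) : List Bool := (splitItem w).1

/-- The encoded sequence of words without its first item. -/
def tailItems (w : List Bool) : List Bool := (splitItem w).2

theorem encWords_cons (x : List Bool) (l : List (List Bool)) :
    encWords (x :: l) = consItem x (encWords l) := by
  induction x with
  | nil => rfl
  | cons b x ih => exact congrArg (true :: b :: ·) ih

theorem length_consItem (x w : List Bool) :
    (consItem x w).length = 2 * x.length + 1 + w.length := by
  induction x with
  | nil => simp only [consItem, List.length_cons, List.length_nil]; omega
  | cons b x ih => simp only [consItem, List.length_cons, ih]; omega

theorem splitItem_consItem (x w : List Bool) : splitItem (consItem x w) = (x, w) := by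
  induction x with
  | nil => rfl
  | cons b x ih => simp only [consItem, splitItem, ih]

@[simp]
theorem headItem_consItem (x w : List Bool) : headItem (consItem x w) = x := by
  rw [headItem, splitItem_consItem]

@[simp]
theorem tailItems_consItem (x w : List Bool) : tailItems (consItem x w) = w := by
  rw [tailItems, splitItem_consItem]

theorem length_headItem_add_length_tailItems_le (w : List Bool) :
    2 * (headItem w).length + (tailItems w).length ≤ w.length := by
  unfold headItem tailItems
  induction w using splitItem.induct with grind [splitItem]

theorem length_tailItems_lt {w : List Bool} (hw : w ≠ []) :
    (tailItems w).length < w.length := by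
  unfold tailItems
  induction w using splitItem.induct with grind [splitItem]

/-- The sequence of words encoded by a word. -/
def items (w : List Bool) : List (List Bool) :=
  if _hw : w = [] then [] else headItem w :: items (tailItems w)
termination_by w.length
decreasing_by exact length_tailItems_lt _hw

@[simp]
theorem items_nil : items [] = [] := by
  rw [items, dif_pos rfl]

theorem items_of_ne_nil {w : List Bool} (hw : w ≠ []) :
    items w = headItem w :: items (tailItems w) := by
  rw [items, dif_neg hw]

theorem consItem_ne_nil (x w : List Bool) : consItem x w ≠ [] := by
  cases x <;> exact List.cons_ne_nil _ _

theorem items_consItem (x w : List Bool) : items (consItem x w) = x :: items w := by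
  rw [items_of_ne_nil (consItem_ne_nil x w), headItem_consItem, tailItems_consItem]

@[simp]
theorem items_encWords (l : List (List Bool)) : items (encWords l) = l := by
  induction l with
  | nil => exact items_nil
  | cons x l ih => rw [encWords_cons, items_consItem, ih]

/-- The item number `n` of an encoded sequence of words, counted from `0`. -/
def item (n : ℕ) (w : List Bool) : List Bool := headItem (tailItems^[n] w)

theorem item_encWords (n : ℕ) (l : List (List Bool)) : item n (encWords l) = l.getD n [] := by
  induction n generalizing l with
  | zero => cases l <;> simp [item, encWords_cons]; rfl
  | succ n ih =>
    cases l with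
    | nil => exact ih []
    | cons x l => simpa [item, encWords_cons] using ih l

theorem length_encWords_le_of_sublist {l l' : List (List Bool)} (h : l.Sublist l') :
    (encWords l).length ≤ (encWords l').length := by
  induction h with
  | slnil => rfl
  | cons x _ ih => rw [encWords_cons, length_consItem]; omega
  | cons_cons x _ ih => simp only [encWords_cons, length_consItem]; omega

theorem length_le_length_encWords_of_mem {l : List (List Bool)} {x : List Bool} (hx : x ∈ l) :
    x.length ≤ (encWords l).length := by
  refine le_trans ?_ (length_encWords_le_of_sublist (List.singleton_sublist.mpr hx))
  rw [encWords_cons, length_consItem]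
  omega

theorem length_le_length_encWords (l : List (List Bool)) : l.length ≤ (encWords l).length := by
  induction l with
  | nil => rfl
  | cons x l ih => rw [encWords_cons, length_consItem, List.length_cons]; omega

theorem length_encWords_le {n : ℕ} {l : List (List Bool)} (hl : ∀ x ∈ l, x.length ≤ n) :
    (encWords l).length ≤ l.length * (2 * n + 1) := by
  induction l with
  | nil => exact Nat.zero_le _
  | cons x l ih =>
    rw [List.forall_mem_cons] at hl
    have := ih hl.2
    rw [encWords_cons, length_consItem, List.length_cons, add_one_mul]
    omega

/-! ## Structured stack programs -/

/-- Structured programs over stacks indexed by `K`, the language in which all algorithms of this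
file are written. The construct `loop k brk f` repeatedly pops the stack `k`; it ends when the
stack was empty or when the popped bit `b` satisfies `brk b`, and otherwise executes `f b`. -/
inductive StackProg (K : Type) : Type
  | skip
  | push (k : K) (b : Bool)
  | pop (k : K) (f : Option Bool → StackProg K)
  | query (k : K) (f : Bool → StackProg K)
  | seq (p q : StackProg K)
  | loop (k : K) (brk : Bool → Bool) (f : Bool → StackProg K)

namespace OracleMachine

variable {T : OracleMachine} {A : Language Bool} {t t' : ℕ} {c c' c'' : T.Cfg}

/-- The configuration `c'` is reached from `c` after at most `t` steps. -/
def ReachesIn (T : OracleMachine) (A : Language Bool) (t : ℕ) (c c' : T.Cfg) : Prop :=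
  ∃ n ≤ t, (T.step A)^[n] c = c'

theorem ReachesIn.refl (c : T.Cfg) : T.ReachesIn A t c c :=
  ⟨0, t.zero_le, rfl⟩

theorem ReachesIn.mono (h : T.ReachesIn A t c c') (ht : t ≤ t') : T.ReachesIn A t' c c' :=
  h.imp fun _ hn => ⟨hn.1.trans ht, hn.2⟩

theorem ReachesIn.trans (h : T.ReachesIn A t c c') (h' : T.ReachesIn A t' c' c'') :
    T.ReachesIn A (t + t') c c'' := by
  obtain ⟨n, hn, rfl⟩ := h
  obtain ⟨n', hn', rfl⟩ := h'
  exact ⟨n' + n, by omega, Function.iterate_add_apply _ _ _ _⟩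

theorem ReachesIn.of_step_eq (h : T.step A c = c') : T.ReachesIn A 1 c c' :=
  ⟨1, le_rfl, h⟩

theorem ReachesIn.verdict_iterate {b : Bool} (h : T.ReachesIn A t c c')
    (hb : T.instr c'.state = .halt b) : T.verdict ((T.step A)^[t] c) = some b := by
  obtain ⟨n, hn, rfl⟩ := h
  obtain ⟨d, rfl⟩ := Nat.exists_eq_add_of_le' hn
  have hfixed : T.step A ((T.step A)^[n] c) = (T.step A)^[n] c := by
    simp only [step.eq_def T A ((T.step A)^[n] c), hb]
  rw [Function.iterate_add_apply, Function.iterate_fixed hfixed, verdict, hb]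

end OracleMachine

namespace StackProg

infixr:60 " ;; " => StackProg.seq

variable {K : Type}

section Semantics

variable [DecidableEq K]

open Classical in
/-- Executing a program with oracle `A` on the stacks `s` ends with the stacks `s'` after at most
`t` elementary machine operations. -/
inductive RunsIn (A : Language Bool) :
    StackProg K → (K → List Bool) → ℕ → (K → List Bool) → Prop
  | skip (s) : RunsIn A skip s 0 s
  | push (k b s) : RunsIn A (push k b) s 1 (Function.update s k (b :: s k))
  | pop {k f s t s'} (h : RunsIn A (f (s k).head?) (Function.update s k (s k).tail) t s') :
      RunsIn A (pop k f) s (1 + t) s'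
  | query {k f s t s'} (h : RunsIn A (f (decide (s k ∈ A))) s t s') :
      RunsIn A (query k f) s (1 + t) s'
  | seq {p q s t s' t' s''} (h : RunsIn A p s t s') (h' : RunsIn A q s' t' s'') :
      RunsIn A (p ;; q) s (t + t') s''
  | loop_nil {k brk f s} (h : s k = []) : RunsIn A (loop k brk f) s 1 s
  | loop_brk {k brk f s b w} (h : s k = b :: w) (hb : brk b = true) :
      RunsIn A (loop k brk f) s 1 (Function.update s k w)
  | loop_cons {k brk f s b w t s' t' s''} (h : s k = b :: w) (hb : brk b = false)
      (h₁ : RunsIn A (f b) (Function.update s k w) t s')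
      (h₂ : RunsIn A (loop k brk f) s' t' s'') :
      RunsIn A (loop k brk f) s (1 + t + t') s''
  | mono {p s t t' s'} (h : RunsIn A p s t s') (ht : t ≤ t') : RunsIn A p s t' s'

variable {A : Language Bool} {p : StackProg K} {s s' s'' : K → List Bool} {t t' : ℕ}

theorem RunsIn.congr (h : RunsIn A p s t s') (hs : s' = s'') (ht : t ≤ t') :
    RunsIn A p s t' s'' :=
  hs ▸ h.mono ht

theorem RunsIn.length_le (h : RunsIn A p s t s') (k : K) :
    (s' k).length ≤ (s k).length + t := by
  induction h with grind [Function.update_apply]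

end Semantics

/-! ### Compilation to oracle machines -/

/-- The control states needed for a program: one for each of its elementary operations. -/
def Label : StackProg K → Type
  | skip => Empty
  | push _ _ => Unit
  | pop _ f => Unit ⊕ (Σ o, Label (f o))
  | query _ f => Unit ⊕ (Σ b, Label (f b))
  | seq p q => Label p ⊕ Label q
  | loop _ _ f => Unit ⊕ (Σ b, Label (f b))

theorem finite_label : (p : StackProg K) → Finite (Label p)
  | skip => inferInstanceAs (Finite Empty)
  | push _ _ => inferInstanceAs (Finite Unit)
  | pop _ f =>
    have := fun o => finite_label (f o)
    inferInstanceAs (Finite (Unit ⊕ (Σ o, Label (f o))))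
  | query _ f =>
    have := fun b => finite_label (f b)
    inferInstanceAs (Finite (Unit ⊕ (Σ b, Label (f b))))
  | seq p q =>
    have := finite_label p
    have := finite_label q
    inferInstanceAs (Finite (Label p ⊕ Label q))
  | loop _ _ f =>
    have := fun b => finite_label (f b)
    inferInstanceAs (Finite (Unit ⊕ (Σ b, Label (f b))))

/-- The state in which a program embedded by `emb` starts, when it is to continue at `nxt`. -/
def entry {Λ : Type} : (p : StackProg K) → (Label p → Λ) → Λ → Λ
  | skip, _, nxt => nxt
  | push _ _, emb, _ => emb ()
  | pop _ _, emb, _ => emb (.inl ())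
  | query _ _, emb, _ => emb (.inl ())
  | seq p q, emb, nxt => entry p (fun l => emb (.inl l)) (entry q (fun l => emb (.inr l)) nxt)
  | loop _ _ _, emb, _ => emb (.inl ())

/-- The machine instructions of a program embedded by `emb` that continues at `nxt`. -/
def code {Λ : Type} : (p : StackProg K) → (Label p → Λ) → Λ → Label p → OracleInstr K Λ
  | skip, _, _ => fun l => nomatch (show Empty from l)
  | push k b, _, nxt => fun _ => .push k b nxt
  | pop k f, emb, nxt => fun l => match l with
    | .inl _ => .pop k fun o => entry (f o) (fun l => emb (.inr ⟨o, l⟩)) nxt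
    | .inr ⟨o, l⟩ => code (f o) (fun l => emb (.inr ⟨o, l⟩)) nxt l
  | query k f, emb, nxt => fun l => match l with
    | .inl _ => .query k fun b => entry (f b) (fun l => emb (.inr ⟨b, l⟩)) nxt
    | .inr ⟨b, l⟩ => code (f b) (fun l => emb (.inr ⟨b, l⟩)) nxt l
  | seq p q, emb, nxt => fun l => match l with
    | .inl l => code p (fun l => emb (.inl l)) (entry q (fun l => emb (.inr l)) nxt) l
    | .inr l => code q (fun l => emb (.inr l)) nxt l
  | loop k brk f, emb, nxt => fun l => match l with
    | .inl _ => .pop k fun o => match o with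
      | none => nxt
      | some b => if brk b then nxt else
          entry (f b) (fun l => emb (.inr ⟨b, l⟩)) (emb (.inl ()))
    | .inr ⟨b, l⟩ => code (f b) (fun l => emb (.inr ⟨b, l⟩)) (emb (.inl ())) l

section Simulation

variable {T : OracleMachine} {A : Language Bool} {s s' : T.K → List Bool}

theorem step_entry_loop {k : T.K} {brk : Bool → Bool} {f : Bool → StackProg T.K}
    {emb : Label (loop k brk f) → T.Λ} {nxt : T.Λ}
    (hT : ∀ l, T.instr (emb l) = code (loop k brk f) emb nxt l) :
    T.step A ⟨entry (loop k brk f) emb nxt, s⟩ =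
      ⟨match (s k).head? with
        | none => nxt
        | some b => if brk b then nxt else
            entry (f b) (fun l => emb (.inr ⟨b, l⟩)) (emb (.inl ())),
        Function.update s k (s k).tail⟩ := by
  simp only [OracleMachine.step, entry, hT (.inl ()), code]

theorem RunsIn.reachesIn {p : StackProg T.K} {t : ℕ} (h : RunsIn A p s t s') :
    ∀ (emb : Label p → T.Λ) (nxt : T.Λ), (∀ l, T.instr (emb l) = code p emb nxt l) →
      T.ReachesIn A t ⟨entry p emb nxt, s⟩ ⟨nxt, s'⟩ := by
  induction h with
  | skip s => exact fun emb nxt _ => .refl _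
  | push k b s =>
    intro emb nxt hT
    refine .of_step_eq ?_
    simp only [OracleMachine.step, entry, hT (), code]
  | pop _ ih =>
    intro emb nxt hT
    refine (OracleMachine.ReachesIn.of_step_eq ?_).trans
      (ih (fun l => emb (.inr ⟨_, l⟩)) nxt fun l => by simpa only [code] using hT (.inr ⟨_, l⟩))
    simp only [OracleMachine.step, entry, hT (.inl ()), code]
  | query _ ih =>
    intro emb nxt hT
    refine (OracleMachine.ReachesIn.of_step_eq ?_).trans
      (ih (fun l => emb (.inr ⟨_, l⟩)) nxt fun l => by simpa only [code] using hT (.inr ⟨_, l⟩))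
    simp only [OracleMachine.step, entry, hT (.inl ()), code]
  | seq _ _ ih ih' =>
    exact fun emb nxt hT =>
      (ih _ _ fun l => hT (.inl l)).trans (ih' _ nxt fun l => hT (.inr l))
  | loop_nil h =>
    refine fun emb nxt hT => .of_step_eq ((step_entry_loop hT).trans ?_)
    simp only [h, List.head?_nil, List.tail_nil]
    rw [← h, Function.update_eq_self]
  | loop_brk h hb =>
    refine fun emb nxt hT => .of_step_eq ((step_entry_loop hT).trans ?_)
    simp only [h, List.head?_cons, hb, if_true, List.tail_cons]
  | loop_cons h hb _ _ ih₁ ih₂ =>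
    intro emb nxt hT
    refine ((OracleMachine.ReachesIn.of_step_eq ((step_entry_loop hT).trans ?_)).trans
      (ih₁ (fun l => emb (.inr ⟨_, l⟩)) (emb (.inl ())) fun l => by
        simpa only [code] using hT (.inr ⟨_, l⟩))).trans (ih₂ emb nxt hT)
    simp only [h, List.head?_cons, hb, List.tail_cons]
    rfl
  | mono _ ht ih => exact fun emb nxt hT => (ih emb nxt hT).mono ht

end Simulation

section Machine

variable [DecidableEq K]

/-- The machine that executes a program on the input stack `k` and then halts, with the top bit of
the stack `k` as verdict. -/
noncomputable def machine [Fintype K] (p : StackProg K) (k : K) : OracleMachine where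
  K := K
  Λ := Label p ⊕ Option Bool
  fintypeΛ := have := finite_label p; Fintype.ofFinite _
  input := k
  start := entry p Sum.inl (.inr none)
  instr
    | .inl l => code p Sum.inl (.inr none) l
    | .inr none => .pop k fun o => .inr (some (o.getD false))
    | .inr (some b) => .halt b

open Classical in
theorem mem_PRel [Finite K] {A V : Language Bool} (p : StackProg K) (k : K) (T : Polynomial ℕ)
    (h : ∀ w, ∃ s, RunsIn A p (Function.update (fun _ => []) k w) (T.eval w.length) s ∧
      s k = [decide (w ∈ V)]) :
    V ∈ PRel A := by
  have := Fintype.ofFinite K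
  refine ⟨machine p k, T + 1, fun w => ⟨decide (w ∈ V), ?_, decide_eq_true_iff⟩⟩
  obtain ⟨s, hrun, hs⟩ := h w
  have hreach : (machine p k).ReachesIn A (T.eval w.length) ((machine p k).init w)
      ⟨.inr none, s⟩ :=
    RunsIn.reachesIn (T := machine p k) hrun Sum.inl (.inr none) fun _ => rfl
  have hhalt : (machine p k).step A ⟨.inr none, s⟩ =
      ⟨.inr (some (decide (w ∈ V))), Function.update s k []⟩ := by
    simp only [OracleMachine.step, machine, hs]
    rfl
  rw [Polynomial.eval_add, Polynomial.eval_one]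
  exact (hreach.trans (.of_step_eq hhalt)).verdict_iterate rfl

end Machine

/-! ### Basic programs -/

variable [DecidableEq K] {A : Language Bool} {s : K → List Bool} {k a c : K}

open Function (update)

theorem runsIn_pop_nil {f : Option Bool → StackProg K} {s' : K → List Bool} {t : ℕ}
    (hk : s k = []) (h : RunsIn A (f none) s t s') : RunsIn A (pop k f) s (1 + t) s' := by
  refine .pop ?_
  rwa [hk, List.head?_nil, List.tail_nil, ← hk, Function.update_eq_self]

theorem runsIn_pop_cons {f : Option Bool → StackProg K} {s' : K → List Bool} {t : ℕ} {b : Bool}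
    {w : List Bool} (hk : s k = b :: w) (h : RunsIn A (f (some b)) (update s k w) t s') :
    RunsIn A (pop k f) s (1 + t) s' := by
  refine .pop ?_
  rwa [hk, List.head?_cons, List.tail_cons]

/-- Empties the stack `k`. -/
def clear (k : K) : StackProg K :=
  loop k (fun _ => false) fun _ => skip

theorem runsIn_clear : RunsIn A (clear k) s ((s k).length + 1) (update s k []) := by
  induction hw : s k generalizing s with
  | nil => exact (RunsIn.loop_nil hw).congr (by grind) (by simp)
  | cons b w ih =>
    exact (RunsIn.loop_cons hw rfl (.skip _) (ih (s := update s k w) (by grind))).congr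
      (by grind) (by grind)

/-- Moves the content of the stack `k` to the stack `a`, in reversed order. -/
def move (k a : K) : StackProg K :=
  loop k (fun _ => false) fun b => push a b

theorem runsIn_move (hka : k ≠ a) :
    RunsIn A (move k a) s (2 * (s k).length + 1)
      (update (update s k []) a ((s k).reverse ++ s a)) := by
  induction hw : s k generalizing s with
  | nil => exact (RunsIn.loop_nil hw).congr (by funext i; grind) (by simp)
  | cons b w ih =>
    refine (RunsIn.loop_cons hw rfl (.push a b _) (ih (by grind))).congr ?_ (by grind)
    funext i; grind

/-- Copies the content of the stack `k` to the stack `a`, by means of the empty stack `c`. -/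
def copy (k a c : K) : StackProg K :=
  move k c ;; loop c (fun _ => false) fun b => push k b ;; push a b

theorem runsIn_copy (hka : k ≠ a) (hkc : k ≠ c) (hac : a ≠ c) (ha : s a = []) (hc : s c = []) :
    RunsIn A (copy k a c) s (5 * (s k).length + 2) (update s a (s k)) := by
  have hback (s : K → List Bool) : RunsIn A (loop c (fun _ => false) fun b => push k b ;; push a b)
      s (3 * (s c).length + 1)
      (update (update (update s c []) k ((s c).reverse ++ s k)) a ((s c).reverse ++ s a)) := by
    induction hw : s c generalizing s with
    | nil => exact (RunsIn.loop_nil hw).congr (by funext i; grind) (by simp)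
    | cons b w ih =>
      refine (RunsIn.loop_cons hw rfl ((RunsIn.push k b _).seq (.push a b _))
        (ih _ (by grind))).congr ?_ (by grind)
      funext i; grind
  refine ((runsIn_move hkc).seq (hback _)).congr ?_ (by grind)
  funext i; grind

/-- Removes the first item of the encoded sequence of words on the stack `k` and puts it, in
reversed order, on the stack `a`. -/
def splitOff (k a : K) : StackProg K :=
  loop k (fun b => !b) fun _ => pop k fun
    | none => skip
    | some b => push a b

theorem runsIn_splitOff (hka : k ≠ a) :
    RunsIn A (splitOff k a) s (2 * (s k).length + 1)
      (update (update s k (tailItems (s k))) a ((headItem (s k)).reverse ++ s a)) := by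
  unfold headItem tailItems
  induction hw : s k using splitItem.induct generalizing s with
  | case1 => exact (RunsIn.loop_nil hw).congr (by funext i; grind [splitItem]) (by simp)
  | case2 =>
    refine (RunsIn.loop_cons hw rfl (runsIn_pop_nil (by grind) (.skip _))
      (.loop_nil (by grind))).congr ?_ (by simp)
    funext i; grind [splitItem]
  | case3 w =>
    refine (RunsIn.loop_brk hw rfl).congr ?_ (by simp)
    funext i; grind [splitItem]
  | case4 b w ih =>
    refine (RunsIn.loop_cons hw rfl (runsIn_pop_cons (w := w) (by grind) (.push a b _))
      (ih (by grind))).congr ?_ (by grind)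
    funext i; grind [splitItem]

/-- Moves the word on the stack `a` as a new first item to the encoded sequence of words on the
stack `k`, by means of the empty stack `c`. -/
def putItem (a k c : K) : StackProg K :=
  move a c ;; push k false ;; loop c (fun _ => false) fun b => push k b ;; push k true

theorem runsIn_putItem (hka : k ≠ a) (hkc : k ≠ c) (hac : a ≠ c) (hc : s c = []) :
    RunsIn A (putItem a k c) s (5 * (s a).length + 3)
      (update (update s a []) k (consItem (s a) (s k))) := by
  have hput (x w : List Bool) (s : K → List Bool) (hw : s k = consItem x w) :
      RunsIn A (loop c (fun _ => false) fun b => push k b ;; push k true) s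
        (3 * (s c).length + 1)
        (update (update s c []) k (consItem ((s c).reverse ++ x) w)) := by
    induction hv : s c generalizing s x with
    | nil => exact (RunsIn.loop_nil hv).congr (by funext i; grind) (by simp)
    | cons b v ih =>
      refine (RunsIn.loop_cons hv rfl ((RunsIn.push k b _).seq (.push k true _))
        (ih (b :: x) _ (by grind [consItem]) (by grind))).congr ?_ (by grind)
      funext i; grind
  refine ((runsIn_move hac).seq ((RunsIn.push k false _).seq
    (hput [] (s k) _ (by grind [consItem])))).congr ?_ (by grind)
  funext i; grind

theorem runsIn_repeat {p : StackProg K} {f : List Bool → List Bool} {t : ℕ} (hka : k ≠ a)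
    (hp : ∀ i < (s a).length, ∀ w : List Bool,
      RunsIn A p (update (update s a w) k (f^[i] (s k))) t
        (update (update s a w) k (f^[i + 1] (s k)))) :
    RunsIn A (loop a (fun _ => false) fun _ => p) s ((s a).length * (t + 1) + 1)
      (update (update s a []) k (f^[(s a).length] (s k))) := by
  have hrest (v : List Bool) (i : ℕ) (hi : i + v.length = (s a).length) :
      RunsIn A (loop a (fun _ => false) fun _ => p) (update (update s a v) k (f^[i] (s k)))
        (v.length * (t + 1) + 1) (update (update s a []) k (f^[(s a).length] (s k))) := by
    induction v generalizing i with
    | nil => exact (RunsIn.loop_nil (by simp [hka.symm])).congr (by simp_all) (by simp)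
    | cons b v ih =>
      rw [List.length_cons] at hi
      refine (RunsIn.loop_cons (b := b) (w := v) (t := t) (by simp [hka.symm]) rfl ?_
        (ih (i + 1) (by omega))).mono (by rw [List.length_cons, add_one_mul]; omega)
      rw [Function.update_comm hka, Function.update_idem]
      exact hp i (by omega) v
  simpa using hrest (s a) 0 (Nat.zero_add _)

end StackProg

/-! ## Functions computable in polynomial time with an oracle -/

open Polynomial in
theorem natPolynomial_eval_mono (T : ℕ[X]) : Monotone fun n => T.eval n := by
  intro m n hmn
  simp only [eval_eq_sum, sum]
  gcongr

namespace StackProg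

variable {m : ℕ}

/-- All stacks with numbers at least `b` are empty, and so they can be used as scratch space. -/
def EmptyFrom (b : ℕ) (s : Fin m → List Bool) : Prop :=
  ∀ i : Fin m, b ≤ i → s i = []

theorem EmptyFrom.update {b b' : ℕ} {s : Fin m → List Bool} (hs : EmptyFrom b s) {k : Fin m}
    (hk : k < b') (hb : b ≤ b') (w : List Bool) : EmptyFrom b' (Function.update s k w) := by
  intro i hi
  rw [Function.update_of_ne (by grind), hs i (hb.trans hi)]

/-- With oracle `A`, the program `p` replaces any word `w` on the stack `k` by `f w` in time
`T |w|`, using the stacks with numbers at least `b` as scratch space. -/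
def Computes (A : Language Bool) (p : StackProg (Fin m)) (b : ℕ) (k : Fin m) (T : Polynomial ℕ)
    (f : List Bool → List Bool) : Prop :=
  ∀ s, EmptyFrom b s →
    RunsIn A p s (T.eval (s k).length) (Function.update s k (f (s k)))

open Function in
theorem Computes.runsIn_repeat {A : Language Bool} {p : StackProg (Fin m)} {b : ℕ} {k a : Fin m}
    {T : Polynomial ℕ} {f : List Bool → List Bool} {s : Fin m → List Bool} {B : ℕ}
    (hp : p.Computes A b k T f) (hka : k ≠ a) (hk : k < b)
    (hs : ∀ w, EmptyFrom b (update s a w))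
    (hB : ∀ i < (s a).length, (f^[i] (s k)).length ≤ B) :
    RunsIn A (loop a (fun _ => false) fun _ => p) s ((s a).length * (T.eval B + 1) + 1)
      (update (update s a []) k (f^[(s a).length] (s k))) := by
  refine StackProg.runsIn_repeat hka fun i hi w =>
    (hp _ ((hs w).update hk le_rfl _)).congr ?_ ?_
  · rw [update_self, update_idem, iterate_succ_apply']
  · rw [update_self]
    exact natPolynomial_eval_mono T (hB i hi)

end StackProg

/-- The function `f` on words is computable in polynomial time with oracle `A`. The program may use
`n` scratch stacks and must be available for every stack `k` and every base `b` of the scratch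
stacks, so that programs can call each other like subroutines with a call stack. -/
def PolyTimeComputable (A : Language Bool) (f : List Bool → List Bool) : Prop :=
  ∃ (n : ℕ) (T : Polynomial ℕ), ∀ (m b : ℕ) (k : Fin m), k < b → b + n ≤ m →
    ∃ p : StackProg (Fin m), p.Computes A b k T f

open Classical in
/-- The property `p` of words is decidable in polynomial time with oracle `A`. -/
def PolyTimeDecidable (A : Language Bool) (p : List Bool → Prop) : Prop :=
  PolyTimeComputable A fun w => [decide (p w)]

namespace PolyTimeComputable

open StackProg Function Polynomial

variable {A : Language Bool} {f g : List Bool → List Bool}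

theorem congr (hf : PolyTimeComputable A f) (h : ∀ w, f w = g w) : PolyTimeComputable A g :=
  funext h ▸ hf

theorem exists_runsIn (hf : PolyTimeComputable A f) :
    ∃ (m : ℕ) (k : Fin m) (p : StackProg (Fin m)) (T : ℕ[X]), ∀ w,
      RunsIn A p (update (fun _ => []) k w) (T.eval w.length) (update (fun _ => []) k (f w)) := by
  obtain ⟨n, T, hT⟩ := hf
  obtain ⟨p, hp⟩ := hT (1 + n) 1 ⟨0, by omega⟩ (by simp) le_rfl
  refine ⟨1 + n, ⟨0, by omega⟩, p, T, fun w => ?_⟩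
  simpa using hp (update (fun _ => []) ⟨0, by omega⟩ w) fun i hi => update_of_ne (by grind) _ _

theorem exists_length_le (hf : PolyTimeComputable A f) :
    ∃ T : ℕ[X], ∀ w, (f w).length ≤ T.eval w.length := by
  obtain ⟨m, k, p, T, hp⟩ := hf.exists_runsIn
  exact ⟨X + T, fun w => by simpa using (hp w).length_le k⟩

theorem of_runsIn (T : ℕ[X]) (p : ∀ {m : ℕ}, Fin m → Fin m → StackProg (Fin m))
    (hp : ∀ {m : ℕ} (k a : Fin m) (s : Fin m → List Bool), k ≠ a → s a = [] →
      RunsIn A (p k a) s (T.eval (s k).length) (update s k (f (s k)))) :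
    PolyTimeComputable A f := by
  refine ⟨1, T, fun m b k hk hm => ⟨p k ⟨b, hm⟩, fun s hs => hp k _ s ?_ (hs _ le_rfl)⟩⟩
  exact Fin.ne_of_val_ne hk.ne

protected theorem id : PolyTimeComputable A fun w => w :=
  of_runsIn 0 (fun _ _ => skip) fun k _ s _ _ => by
    rw [update_eq_self, eval_zero]
    exact .skip s

protected theorem comp (hf : PolyTimeComputable A f) (hg : PolyTimeComputable A g) :
    PolyTimeComputable A fun w => f (g w) := by
  obtain ⟨L, hL⟩ := hg.exists_length_le
  obtain ⟨nf, Tf, hf⟩ := hf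
  obtain ⟨ng, Tg, hg⟩ := hg
  refine ⟨nf + ng, Tg + Tf.comp L, fun m b k hk hm => ?_⟩
  obtain ⟨pf, hpf⟩ := hf m b k hk (by omega)
  obtain ⟨pg, hpg⟩ := hg m b k hk (by omega)
  refine ⟨pg ;; pf, fun s hs => ?_⟩
  refine ((hpg s hs).seq (hpf _ (hs.update hk le_rfl _))).congr (by simp) ?_
  rw [eval_add, eval_comp, update_self]
  exact Nat.add_le_add_left (natPolynomial_eval_mono Tf (hL _)) _

theorem nil : PolyTimeComputable A fun _ => [] :=
  of_runsIn (X + 1) (fun k _ => clear k) fun _ _ _ _ _ => by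
    simpa using runsIn_clear

protected theorem cons (b : Bool) (hf : PolyTimeComputable A f) :
    PolyTimeComputable A fun w => b :: f w :=
  PolyTimeComputable.comp (of_runsIn 1 (fun k _ => push k b) fun k _ s _ _ => by
    simpa using RunsIn.push k b s) hf

protected theorem const (v : List Bool) : PolyTimeComputable A fun _ => v := by
  induction v with
  | nil => exact nil
  | cons b v ih => exact ih.cons b

protected theorem tail (hf : PolyTimeComputable A f) : PolyTimeComputable A fun w => (f w).tail :=
  PolyTimeComputable.comp (of_runsIn 1 (fun k _ => pop k fun _ => skip) fun k _ s _ _ => by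
    simpa using RunsIn.pop (f := fun _ => skip) (.skip (update s k (s k).tail))) hf

protected theorem tailItems (hf : PolyTimeComputable A f) :
    PolyTimeComputable A fun w => tailItems (f w) := by
  refine PolyTimeComputable.comp (of_runsIn (3 * X + 2) (fun k a => splitOff k a ;; clear a) ?_) hf
  intro m k a s hka ha
  have hlen := length_headItem_add_length_tailItems_le (s k)
  refine ((runsIn_splitOff hka).seq runsIn_clear).congr ?_ ?_
  · funext i; grind
  · simp only [ha, List.append_nil, update_self, List.length_reverse, eval_add, eval_mul,
      eval_ofNat, eval_X]
    omega

protected theorem headItem (hf : PolyTimeComputable A f) :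
    PolyTimeComputable A fun w => headItem (f w) := by
  refine PolyTimeComputable.comp
    (of_runsIn (5 * X + 3) (fun k a => splitOff k a ;; clear k ;; move a k) ?_) hf
  intro m k a s hka ha
  have hlen := length_headItem_add_length_tailItems_le (s k)
  refine ((runsIn_splitOff hka).seq (runsIn_clear.seq (runsIn_move hka.symm))).congr ?_ ?_
  · funext i; grind
  · simp only [ha, List.append_nil, update_of_ne hka, update_self, update_of_ne hka.symm,
      List.length_reverse, eval_add, eval_mul, eval_ofNat, eval_X]
    omega

theorem exists_runsIn_update_scratch (hf : PolyTimeComputable A f) :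
    ∃ (n : ℕ) (T : ℕ[X]), ∀ (m b : ℕ) (k a : Fin m), k < b → a.val = b → b + n ≤ m →
      ∃ p : StackProg (Fin m), ∀ s, EmptyFrom b s →
        RunsIn A p s (T.eval (s k).length) (update s a (f (s k))) := by
  obtain ⟨n, T, hf⟩ := hf
  refine ⟨n + 2, 5 * X + 2 + T, fun m b k a hk ha hm => ?_⟩
  obtain ⟨p, hp⟩ := hf m (b + 1) a (by omega) (by omega)
  have hka : k ≠ a := by grind
  let c : Fin m := ⟨b + 1, by omega⟩
  refine ⟨copy k a c ;; p, fun s hs => ?_⟩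
  have hcopy : RunsIn A (copy k a c) s _ (update s a (s k)) :=
    runsIn_copy hka (by grind) (by grind) (hs a ha.ge) (hs c (by grind))
  refine (hcopy.seq (hp _ (hs.update (by omega) (by omega) _))).congr (by simp) ?_
  simp

protected theorem consItem (hf : PolyTimeComputable A f) (hg : PolyTimeComputable A g) :
    PolyTimeComputable A fun w => consItem (f w) (g w) := by
  obtain ⟨L, hL⟩ := hf.exists_length_le
  obtain ⟨nf, Tf, hf⟩ := hf.exists_runsIn_update_scratch
  obtain ⟨ng, Tg, hg⟩ := hg
  refine ⟨nf + ng + 2, Tf + (Tg + (5 * L + 3)), fun m b k hk hm => ?_⟩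
  let a : Fin m := ⟨b, by omega⟩
  let c : Fin m := ⟨b + 1, by omega⟩
  obtain ⟨pf, hpf⟩ := hf m b k a hk rfl (by omega)
  obtain ⟨pg, hpg⟩ := hg m (b + 1) k (by omega) (by omega)
  have hka : k ≠ a := by grind
  refine ⟨pf ;; pg ;; putItem a k c, fun s hs => ?_⟩
  have hs' := hs.update (k := a) (b' := b + 1) (by grind) (by omega) (f (s k))
  refine ((hpf s hs).seq ((hpg _ hs').seq
    (runsIn_putItem hka (by grind) (by grind) ?_))).congr ?_ ?_
  · exact hs'.update (by omega) le_rfl _ c le_rfl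
  · have ha := hs a le_rfl
    funext i; grind
  · have := hL (s k)
    simp only [update_of_ne hka, update_of_ne hka.symm, update_self, eval_add, eval_mul,
      eval_ofNat]
    omega

open Classical in
protected theorem ite {p : List Bool → Prop} (hp : PolyTimeDecidable A p)
    (hf : PolyTimeComputable A f) (hg : PolyTimeComputable A g) :
    PolyTimeComputable A fun w => if p w then f w else g w := by
  obtain ⟨np, Tp, hp⟩ := exists_runsIn_update_scratch hp
  obtain ⟨nf, Tf, hf⟩ := hf
  obtain ⟨ng, Tg, hg⟩ := hg
  refine ⟨np + nf + ng + 1, Tp + (1 + (Tf + Tg)), fun m b k hk hm => ?_⟩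
  let a : Fin m := ⟨b, by omega⟩
  obtain ⟨pp, hpp⟩ := hp m b k a hk rfl (by omega)
  obtain ⟨pf, hpf⟩ := hf m b k hk (by omega)
  obtain ⟨pg, hpg⟩ := hg m b k hk (by omega)
  refine ⟨pp ;; pop a fun o => if o = some true then pf else pg, fun s hs => ?_⟩
  have ha : update (update s a [decide (p (s k))]) a [] = s := by
    rw [update_idem, ← hs a le_rfl, update_eq_self]
  refine ((hpp s hs).seq (runsIn_pop_cons (update_self ..) ?_)).mono (t := Tp.eval (s k).length +
    (1 + (Tf + Tg).eval (s k).length)) (by simp)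
  rw [ha]
  by_cases h : p (s k)
  · simp only [h, decide_true, if_true]
    exact (hpf s hs).mono (by simp)
  · simp only [h, decide_false, Option.some.injEq, Bool.false_eq_true, if_false]
    exact (hpg s hs).mono (by simp)

theorem iterate {c : List Bool → List Bool} (hf : PolyTimeComputable A f)
    (hg : PolyTimeComputable A g) (hc : PolyTimeComputable A c) (B : ℕ[X])
    (hB : ∀ w, ∀ i < (c w).length, (f^[i] (g w)).length ≤ B.eval w.length) :
    PolyTimeComputable A fun w => f^[(c w).length] (g w) := by
  obtain ⟨L, hL⟩ := hc.exists_length_le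
  obtain ⟨nc, Tc, hc⟩ := hc.exists_runsIn_update_scratch
  obtain ⟨ng, Tg, hg⟩ := hg
  obtain ⟨nf, Tf, hf⟩ := hf
  refine ⟨nf + ng + nc + 1, Tc + (Tg + (L * (Tf.comp B + 1) + 1)), fun m b k hk hm => ?_⟩
  let a : Fin m := ⟨b, by omega⟩
  obtain ⟨pc, hpc⟩ := hc m b k a hk rfl (by omega)
  obtain ⟨pg, hpg⟩ := hg m (b + 1) k (by omega) (by omega)
  obtain ⟨pf, hpf⟩ := hf m (b + 1) k (by omega) (by omega)
  have hka : k ≠ a := by grind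
  refine ⟨pc ;; pg ;; loop a (fun _ => false) fun _ => pf, fun s hs => ?_⟩
  have hs' (w : List Bool) : EmptyFrom (b + 1) (update s a w) :=
    hs.update (by grind) (by omega) w
  set n := (s k).length with hn
  have hstart : RunsIn A pg (update s a (c (s k))) (Tg.eval n)
      (update (update s a (c (s k))) k (g (s k))) := by
    simpa [hka, ← hn] using hpg _ (hs' (c (s k)))
  have hloop : RunsIn A (loop a (fun _ => false) fun _ => pf)
      (update (update s a (c (s k))) k (g (s k))) (L.eval n * ((Tf.comp B).eval n + 1) + 1)
      (update (update s a []) k (f^[(c (s k)).length] (g (s k)))) := by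
    refine (hpf.runsIn_repeat (B := B.eval n) hka (by omega) (fun w => ?_) ?_).congr ?_ ?_
    · rw [update_comm hka, update_idem]
      exact (hs' w).update (by omega) le_rfl _
    · simpa [hka.symm] using hB (s k)
    · funext j; grind
    · rw [update_of_ne hka.symm, update_self, eval_comp]
      exact Nat.add_le_add_right (Nat.mul_le_mul_right _ (hL _)) _
  refine ((hpc s hs).seq (hstart.seq hloop)).congr ?_ ?_
  · have ha := hs a le_rfl
    funext j; grind
  · simp [← hn]

end PolyTimeComputable

namespace PolyTimeDecidable

open StackProg Function Polynomial

variable {A : Language Bool} {f g : List Bool → List Bool} {p q : List Bool → Prop}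

open Classical in
theorem mem_PRel (hp : PolyTimeDecidable A p) : {w | p w} ∈ PRel A := by
  obtain ⟨m, k, P, T, hP⟩ := PolyTimeComputable.exists_runsIn hp
  exact StackProg.mem_PRel P k T fun w => ⟨_, hP w, update_self ..⟩

theorem congr (hp : PolyTimeDecidable A p) (h : ∀ w, p w ↔ q w) : PolyTimeDecidable A q :=
  (funext fun w => propext (h w) : p = q) ▸ hp

protected theorem comp (hp : PolyTimeDecidable A p) (hf : PolyTimeComputable A f) :
    PolyTimeDecidable A fun w => p (f w) :=
  PolyTimeComputable.comp hp hf

theorem mem_oracle (hf : PolyTimeComputable A f) : PolyTimeDecidable A fun w => f w ∈ A := by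
  refine PolyTimeDecidable.comp (p := (· ∈ A)) (.of_runsIn (X + 3)
    (fun k _ => query k fun b => clear k ;; push k b) fun k _ s _ _ => ?_) hf
  refine (RunsIn.query (runsIn_clear.seq (.push k _ _))).congr ?_ ?_
  · simp
  · simp only [eval_add, eval_X, eval_ofNat]
    omega

theorem head?_eq (o : Option Bool) (hf : PolyTimeComputable A f) :
    PolyTimeDecidable A fun w => (f w).head? = o := by
  refine PolyTimeDecidable.comp (p := (List.head? · = o)) (.of_runsIn (X + 3)
    (fun k _ => pop k fun o' => clear k ;; push k (decide (o' = o))) fun k _ s _ _ => ?_) hf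
  refine (RunsIn.pop (runsIn_clear.seq (.push k _ _))).congr ?_ ?_
  · simp only [update_idem, update_self]
    congr
  · simp only [update_self, List.length_tail, eval_add, eval_X, eval_ofNat]
    omega

theorem eq_nil (hf : PolyTimeComputable A f) : PolyTimeDecidable A fun w => f w = [] := by
  simpa only [List.head?_eq_none_iff] using head?_eq none hf

protected theorem not (hp : PolyTimeDecidable A p) : PolyTimeDecidable A fun w => ¬ p w := by
  refine (PolyTimeComputable.ite hp (.const [false]) (.const [true])).congr fun w => ?_
  by_cases h : p w <;> simp [h]

protected theorem and (hp : PolyTimeDecidable A p) (hq : PolyTimeDecidable A q) :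
    PolyTimeDecidable A fun w => p w ∧ q w := by
  refine (PolyTimeComputable.ite hp hq (.const [false])).congr fun w => ?_
  by_cases h : p w <;> simp [h]

protected theorem or (hp : PolyTimeDecidable A p) (hq : PolyTimeDecidable A q) :
    PolyTimeDecidable A fun w => p w ∨ q w := by
  refine (PolyTimeComputable.ite hp (.const [true]) hq).congr fun w => ?_
  by_cases h : p w <;> simp [h]

theorem head?_eq_head? (hf : PolyTimeComputable A f) (hg : PolyTimeComputable A g) :
    PolyTimeDecidable A fun w => (f w).head? = (g w).head? := by
  have hsplit (o o' : Option Bool) : o = o' ↔ (o = none ∧ o' = none) ∨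
      (o = some false ∧ o' = some false) ∨ (o = some true ∧ o' = some true) := by
    revert o o'; decide
  refine (((head?_eq _ hf).and (head?_eq _ hg)).or (((head?_eq _ hf).and (head?_eq _ hg)).or
    ((head?_eq _ hf).and (head?_eq _ hg)))).congr fun w => (hsplit _ _).symm

/-- The step of the comparison of two words: if the words `x` and `y` of the pair `consItem x y`
begin with the same bit, it is removed from both. -/
def stripHeads (v : List Bool) : List Bool :=
  if (headItem v).head? = (tailItems v).head? then
    consItem (headItem v).tail (tailItems v).tail
  else v

theorem stripHeads_consItem (x y : List Bool) :
    stripHeads (consItem x y) =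
      if x.head? = y.head? then consItem x.tail y.tail else consItem x y := by
  simp only [stripHeads, headItem_consItem, tailItems_consItem]

theorem length_iterate_stripHeads_le (n : ℕ) (x y : List Bool) :
    (stripHeads^[n] (consItem x y)).length ≤ (consItem x y).length := by
  induction n generalizing x y with
  | zero => rfl
  | succ n ih =>
    rw [iterate_succ_apply, stripHeads_consItem]
    split_ifs
    · refine (ih _ _).trans ?_
      simp only [length_consItem, List.length_tail]
      omega
    · exact ih x y

theorem head?_iterate_stripHeads (x y : List Bool) :
    (headItem (stripHeads^[x.length] (consItem x y))).head? =
      (tailItems (stripHeads^[x.length] (consItem x y))).head? ↔ x = y := by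
  induction x generalizing y with
  | nil => cases y <;> simp
  | cons b x ih =>
    by_cases h : y.head? = some b
    · obtain ⟨y, rfl⟩ := List.head?_eq_some_iff.mp h
      simp [stripHeads_consItem, ih]
    · have hfix : stripHeads (consItem (b :: x) y) = consItem (b :: x) y := by
        rw [stripHeads_consItem, if_neg (by rwa [List.head?_cons, eq_comm])]
      rw [iterate_fixed hfix]
      cases y <;> grind [headItem_consItem, tailItems_consItem]

theorem polyTimeComputable_stripHeads : PolyTimeComputable A stripHeads := by
  have hid := PolyTimeComputable.id (A := A)
  refine (PolyTimeComputable.ite (head?_eq_head? hid.headItem hid.tailItems)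
    (hid.headItem.tail.consItem hid.tailItems.tail) hid).congr fun v => ?_
  unfold stripHeads
  congr

protected theorem eq (hf : PolyTimeComputable A f) (hg : PolyTimeComputable A g) :
    PolyTimeDecidable A fun w => f w = g w := by
  have hfg := hf.consItem hg
  obtain ⟨L, hL⟩ := hfg.exists_length_le
  have hstrip := polyTimeComputable_stripHeads.iterate hfg hf L fun w i _ =>
    (length_iterate_stripHeads_le i _ _).trans (hL w)
  exact (head?_eq_head? hstrip.headItem hstrip.tailItems).congr fun w =>
    head?_iterate_stripHeads (f w) (g w)

end PolyTimeDecidable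

/-! ## Selecting items -/

open Classical in
/-- The encoded sequence of the items of `w` that satisfy `p`, in reverse order, in which a single
pass through `w` collects them. -/
noncomputable def selectItems (p : List Bool → Prop) (w : List Bool) : List Bool :=
  encWords ((items w).filter p).reverse

theorem selectItems_eq_nil_iff {p : List Bool → Prop} {w : List Bool} :
    selectItems p w = [] ↔ ∀ u ∈ items w, ¬ p u := by
  have hnil (l : List (List Bool)) : encWords l = [] ↔ l = [] :=
    ⟨fun h => by rw [← items_encWords l, h, items_nil], fun h => h ▸ rfl⟩
  rw [selectItems, hnil, List.reverse_eq_nil_iff, List.filter_eq_nil_iff]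
  simp only [decide_eq_true_eq]

namespace PolyTimeComputable

open Function Polynomial

section Selection

variable {q : List Bool → List Bool → Prop}

open Classical in
/-- A step of the selection of items. The state consists of the items still to be inspected, the
items selected so far, and a parameter. -/
noncomputable def selectStep (q : List Bool → List Bool → Prop) (v : List Bool) : List Bool :=
  if headItem v = [] then v
  else if q (headItem (headItem v)) (tailItems (tailItems v)) then
    consItem (tailItems (headItem v)) (consItem
      (consItem (headItem (headItem v)) (headItem (tailItems v))) (tailItems (tailItems v)))
  else consItem (tailItems (headItem v)) (tailItems v)

open Classical in
theorem selectStep_consItem (l acc w : List Bool) :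
    selectStep q (consItem l (consItem acc w)) =
      if l = [] then consItem l (consItem acc w)
      else consItem (tailItems l)
        (consItem (if q (headItem l) w then consItem (headItem l) acc else acc) w) := by
  simp only [selectStep, headItem_consItem, tailItems_consItem]
  split_ifs <;> rfl

open Classical in
theorem iterate_selectStep (n : ℕ) (l : List Bool) (hl : l.length ≤ n) (c : List (List Bool))
    (w : List Bool) :
    (selectStep q)^[n] (consItem l (consItem (encWords c) w)) =
      consItem [] (consItem (encWords (((items l).filter (q · w)).reverse ++ c)) w) := by
  induction n generalizing l c with
  | zero =>
    obtain rfl := List.length_eq_zero_iff.mp (Nat.le_zero.mp hl)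
    simp
  | succ n ih =>
    rw [iterate_succ_apply, selectStep_consItem]
    by_cases h : l = []
    · simp [h, ih]
    · have := length_tailItems_lt h
      rw [if_neg h, items_of_ne_nil h]
      by_cases hq : q (headItem l) w
      · rw [if_pos hq, ← encWords_cons, ih _ (by omega), List.filter_cons_of_pos (by simpa)]
        simp
      · rw [if_neg hq, ih _ (by omega), List.filter_cons_of_neg (by simpa)]

theorem length_iterate_selectStep_le (n : ℕ) (l acc w : List Bool) :
    ((selectStep q)^[n] (consItem l (consItem acc w))).length ≤
      4 * l.length + 2 * acc.length + w.length + 2 := by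
  induction n generalizing l acc with
  | zero => simp only [iterate_zero, id, length_consItem]; omega
  | succ n ih =>
    rw [iterate_succ_apply, selectStep_consItem]
    split_ifs with h hq
    · exact ih l acc
    all_goals
      have := length_tailItems_lt h
      have := length_headItem_add_length_tailItems_le l
      refine (ih _ _).trans ?_
      try rw [length_consItem]
      omega

protected theorem selectItems {A : Language Bool} {g : List Bool → List Bool}
    (hq : PolyTimeDecidable A fun v => q (headItem v) (tailItems v))
    (hg : PolyTimeComputable A g) : PolyTimeComputable A fun w => selectItems (q · w) (g w) := by
  have hid := PolyTimeComputable.id (A := A)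
  have hqv : PolyTimeDecidable A fun v => q (headItem (headItem v)) (tailItems (tailItems v)) :=
    (hq.comp (hid.headItem.headItem.consItem hid.tailItems.tailItems)).congr fun v => by
      rw [headItem_consItem, tailItems_consItem]
  have hstep : PolyTimeComputable A (selectStep q) := by
    refine (PolyTimeComputable.ite (.eq_nil hid.headItem) hid
      (.ite hqv
        (hid.headItem.tailItems.consItem
          ((hid.headItem.headItem.consItem hid.tailItems.headItem).consItem
            hid.tailItems.tailItems))
        (hid.headItem.tailItems.consItem hid.tailItems))).congr fun v => ?_
    unfold selectStep
    congr
  have hstart : PolyTimeComputable A fun w => consItem (g w) (consItem [] w) :=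
    hg.consItem (nil.consItem hid)
  obtain ⟨L, hL⟩ := hg.exists_length_le
  have hiterate := hstep.iterate hstart hg (4 * L + X + 2) fun w i _ => by
    refine (length_iterate_selectStep_le i _ _ _).trans ?_
    have := hL w
    simp only [List.length_nil, eval_add, eval_mul, eval_ofNat, eval_X]
    omega
  refine hiterate.tailItems.headItem.congr fun w => ?_
  have := iterate_selectStep (q := q) _ (g w) le_rfl [] w
  rw [show encWords [] = [] from rfl, List.append_nil] at this
  rw [this, tailItems_consItem, headItem_consItem, selectItems]

end Selection

theorem item {A : Language Bool} {f : List Bool → List Bool} (hf : PolyTimeComputable A f) (n : ℕ) :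
    PolyTimeComputable A fun w => item n (f w) := by
  have htail : PolyTimeComputable A fun w => tailItems^[n] (f w) := by
    induction n with
    | zero => exact hf
    | succ n ih => exact ih.tailItems.congr fun w => (iterate_succ_apply' _ _ _).symm
  exact htail.headItem

end PolyTimeComputable

namespace PolyTimeDecidable

variable {A : Language Bool} {f g : List Bool → List Bool} {q : List Bool → List Bool → Prop}

theorem exists_mem_items (hq : PolyTimeDecidable A fun v => q (headItem v) (tailItems v))
    (hg : PolyTimeComputable A g) : PolyTimeDecidable A fun w => ∃ u ∈ items (g w), q u w := by
  refine (PolyTimeDecidable.eq_nil (hg.selectItems hq)).not.congr fun w => ?_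
  rw [selectItems_eq_nil_iff]
  push Not
  rfl

theorem forall_mem_items (hq : PolyTimeDecidable A fun v => q (headItem v) (tailItems v))
    (hg : PolyTimeComputable A g) : PolyTimeDecidable A fun w => ∀ u ∈ items (g w), q u w := by
  refine (exists_mem_items (q := fun u w => ¬ q u w) hq.not hg).not.congr fun w => ?_
  push Not
  rfl

theorem mem_items (hf : PolyTimeComputable A f) (hg : PolyTimeComputable A g) :
    PolyTimeDecidable A fun w => f w ∈ items (g w) := by
  have hid := PolyTimeComputable.id (A := A)
  refine (exists_mem_items (q := fun u w => u = f w)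
    (.eq hid.headItem (hf.comp hid.tailItems)) hg).congr fun w => ?_
  rw [exists_eq_right]

end PolyTimeDecidable

/-! ## The verifier -/

section Verifier

variable {A : Language Bool}

/-- The word `r`, which encodes a rule, is respected by the set `I` of the atoms listed by `i`:
the rule does not derive an atom outside `I`, where `m` lists an interpretation and a false
aggregate atom of the rule is recognized by asking the oracle about the sets of the atoms of `m`
that are listed by `i` or by one of the items of `js`. -/
def RespectsWord (A : Language Bool) (m i js r : List Bool) : Prop :=
  item 0 r ∈ items i ∨ (∃ b ∈ items (item 3 r), b ∈ items m) ∨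
    (∃ b ∈ items (item 2 r), b ∉ items i) ∨
    ∃ ℓ ∈ items (item 1 r), ∃ j ∈ items js,
      encWords [ℓ, selectItems (fun a => a ∈ items i ∨ a ∈ items j) m] ∉ A

theorem PolyTimeDecidable.respectsWord {m i js r : List Bool → List Bool}
    (hm : PolyTimeComputable A m) (hi : PolyTimeComputable A i) (hjs : PolyTimeComputable A js)
    (hr : PolyTimeComputable A r) :
    PolyTimeDecidable A fun w => RespectsWord A (m w) (i w) (js w) (r w) := by
  have hid := PolyTimeComputable.id (A := A)
  have hselect : PolyTimeComputable A fun v =>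
      selectItems (fun a => a ∈ items (i (tailItems (tailItems v))) ∨ a ∈ items (headItem v))
        (m (tailItems (tailItems v))) :=
    .selectItems (q := fun a v => a ∈ items (i (tailItems (tailItems v))) ∨ a ∈ items (headItem v))
      (.or (.mem_items hid.headItem (hi.comp hid.tailItems.tailItems.tailItems))
        (.mem_items hid.headItem hid.tailItems.headItem)) (hm.comp hid.tailItems.tailItems)
  have hquery : PolyTimeDecidable A fun v => encWords [headItem (tailItems v), selectItems
      (fun a => a ∈ items (i (tailItems (tailItems v))) ∨ a ∈ items (headItem v))
      (m (tailItems (tailItems v)))] ∉ A := by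
    simp only [encWords_cons]
    exact .not (.mem_oracle (hid.tailItems.headItem.consItem (hselect.consItem .nil)))
  have hneg : PolyTimeDecidable A fun w => ∃ b ∈ items (item 3 (r w)), b ∈ items (m w) :=
    .exists_mem_items (q := fun b w => b ∈ items (m w))
      (.mem_items hid.headItem (hm.comp hid.tailItems)) (hr.item 3)
  have hpos : PolyTimeDecidable A fun w => ∃ b ∈ items (item 2 (r w)), b ∉ items (i w) :=
    .exists_mem_items (q := fun b w => b ∉ items (i w))
      (.not (.mem_items hid.headItem (hi.comp hid.tailItems))) (hr.item 2)
  exact .or (.mem_items (hr.item 0) hi) (.or hneg (.or hpos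
    (.exists_mem_items (.exists_mem_items hquery (hjs.comp hid.tailItems)) (hr.item 1))))

/-- The word `c` is a certificate that the instance `w` of the answer set checking problem has a
negative answer. Either the interpretation is not closed under the rules, which needs no
certificate, or the first item of `c` lists a proper subset that respects all rules. The other
items of `c` list sets which falsify aggregate atoms. -/
def Refutes (A : Language Bool) (w c : List Bool) : Prop :=
  (∃ r ∈ items (item 0 w), ¬ RespectsWord A (item 1 w) (item 1 w) (encWords [[]]) r) ∨
    (∃ a ∈ items (item 1 w), a ∉ items (headItem c)) ∧ ∀ r ∈ items (item 0 w),
      RespectsWord A (item 1 w) (selectItems (· ∈ items (headItem c)) (item 1 w)) (tailItems c) r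

theorem PolyTimeDecidable.refutes {w c : List Bool → List Bool} (hw : PolyTimeComputable A w)
    (hc : PolyTimeComputable A c) : PolyTimeDecidable A fun v => Refutes A (w v) (c v) := by
  have hid := PolyTimeComputable.id (A := A)
  have hm := (hw.item 1).comp hid.tailItems
  have hct := hc.comp hid.tailItems
  have hunclosed : PolyTimeDecidable A fun v => ∃ r ∈ items (item 0 (w v)),
      ¬ RespectsWord A (item 1 (w v)) (item 1 (w v)) (encWords [[]]) r :=
    .exists_mem_items (q := fun r v =>
      ¬ RespectsWord A (item 1 (w v)) (item 1 (w v)) (encWords [[]]) r)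
      (.not (.respectsWord hm hm (.const _) hid.headItem)) (hw.item 0)
  have hproper : PolyTimeDecidable A fun v =>
      ∃ a ∈ items (item 1 (w v)), a ∉ items (headItem (c v)) :=
    .exists_mem_items (q := fun a v => a ∉ items (headItem (c v)))
      (.not (.mem_items hid.headItem hct.headItem)) (hw.item 1)
  have hselect : PolyTimeComputable A fun v =>
      selectItems (· ∈ items (headItem (c v))) (item 1 (w v)) :=
    .selectItems (q := fun a v => a ∈ items (headItem (c v)))
      (.mem_items hid.headItem hct.headItem) (hw.item 1)
  have hclosed : PolyTimeDecidable A fun v => ∀ r ∈ items (item 0 (w v)), RespectsWord A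
      (item 1 (w v)) (selectItems (· ∈ items (headItem (c v))) (item 1 (w v)))
      (tailItems (c v)) r :=
    .forall_mem_items (q := fun r v => RespectsWord A (item 1 (w v))
      (selectItems (· ∈ items (headItem (c v))) (item 1 (w v))) (tailItems (c v)) r)
      (.respectsWord hm (hselect.comp hid.tailItems) hct.tailItems hid.headItem) (hw.item 0)
  exact hunclosed.or (hproper.and hclosed)

theorem mem_PRel_refutes (A : Language Bool) : {v | Refutes A (item 0 v) (item 1 v)} ∈ PRel A :=
  PolyTimeDecidable.mem_PRel (.refutes (.item .id 0) (.item .id 1))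

end Verifier

/-! ## Refuting fixpoint answer sets -/

namespace AspSignature

variable {S : AspSignature} {σ : S.ProgSig} {ℓ : S.AggAtom} {I J M : Set S.Atom}
  {𝒥 : Set (Set S.Atom)}

open Classical in
theorem AggAtom.sat_congr (h : ∀ a, a.pred = ℓ.source.pred → (a ∈ I ↔ a ∈ J)) :
    ℓ.Sat σ I ↔ ℓ.Sat σ J := by
  have hvalue : ℓ.source.value σ I = ℓ.source.value σ J := by
    obtain ⟨g, p | ⟨r, p⟩, o, v⟩ := ℓ
    · exact congrArg Sum.inl (Finset.filter_congr fun a _ => h (p.inst fun _ => a) rfl)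
    · exact congrArg (fun t : Finset _ => Sum.inr (t.val.map fun γ => γ 0))
        (Finset.filter_congr fun γ _ => h (p.inst γ) rfl)
  rw [AggAtom.Sat, hvalue, AggAtom.Sat]

theorem AggAtom.condSat_iff (hM : M ⊆ σ.base) (hI : I ⊆ M) :
    ℓ.CondSat σ I M ↔ ∀ J ∈ Set.Icc I M, ℓ.Sat σ J := by
  constructor
  · rintro ⟨-, -, -, hsat⟩ J ⟨hIJ, hJM⟩
    refine hsat J (hJM.trans hM) (fun a ha => hIJ ha.1.1) ?_
    exact (Set.disjoint_sdiff_left.mono_right hJM).inter_eq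
  · intro hsat
    refine ⟨Set.inter_subset_right, Set.sdiff_subset,
      Set.disjoint_sdiff_right.mono_left fun a ha => ha.1.2, fun J hJ hIJ hJM => ?_⟩
    have hext (a : S.Atom) (ha : a.pred = ℓ.source.pred) :
        a ∈ J ∩ ℓ.ext σ ∪ I ↔ a ∈ J := by
      refine ⟨?_, fun haJ => .inl ⟨haJ, hJ haJ, ha⟩⟩
      rintro (haJ | haI)
      · exact haJ.1
      · exact hIJ ⟨⟨haI, hI haI⟩, hM (hI haI), ha⟩
    rw [← AggAtom.sat_congr hext]
    refine hsat _ ⟨Set.subset_union_right, Set.union_subset (fun a ha => ?_) hI⟩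
    by_contra haM
    exact Set.eq_empty_iff_forall_notMem.mp hJM a ⟨⟨ha.2, haM⟩, ha.1⟩

theorem AggAtom.CondSat.mono (h : ℓ.CondSat σ I M) (hI : I ⊆ J) : ℓ.CondSat σ J M :=
  ⟨Set.inter_subset_right, Set.sdiff_subset,
    Set.disjoint_sdiff_right.mono_left fun _ ha => ha.1.2, fun X hX hJX hXM =>
    h.2.2.2 X hX (fun _ ha => hJX ⟨⟨hI ha.1.1, ha.1.2⟩, ha.2⟩) hXM⟩

namespace Program

variable (P : S.Program)

theorem K_mono (M : Set S.Atom) : Monotone (P.K M) := by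
  rintro I I' hI a ⟨r, hr, hpos, hagg, rfl⟩
  exact ⟨r, hr, fun b hb => hI (hpos b hb), fun ℓ hℓ => (hagg ℓ hℓ).mono hI, rfl⟩

theorem K_subset_base (M I : Set S.Atom) : P.K M I ⊆ P.sig.base := by
  rintro a ⟨-, ⟨r, hr, -, rfl⟩, -, -, rfl⟩
  exact (P.rules_over r hr).1

theorem isFixpointAnswerSet_iff (hM : M ⊆ P.sig.base) :
    P.IsFixpointAnswerSet M ↔ P.K M M ⊆ M ∧ ∀ I ⊆ M, P.K M I ⊆ I → I = M := by
  let f : Set S.Atom →o Set S.Atom := ⟨P.K M, P.K_mono M⟩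
  have hfix : P.K M f.lfp = f.lfp := f.map_lfp
  constructor
  · rintro ⟨⟨-, hKM⟩, hleast⟩
    refine ⟨hKM.le, fun I hI hK => hI.antisymm ?_⟩
    exact (hleast ⟨hfix ▸ P.K_subset_base M _, hfix⟩).trans (f.lfp_le hK)
  · rintro ⟨hKM, hmin⟩
    have hlfp : f.lfp = M := hmin _ (f.lfp_le hKM) hfix.le
    refine ⟨⟨hM, by rwa [hlfp] at hfix⟩, fun I hI => ?_⟩
    rw [← hlfp]
    exact f.lfp_le hI.2.le

end Program

/-- With respect to `M`, the rule `r` does not derive an atom outside `I`; if this is due to one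
of its aggregate atoms, then one of the sets in `𝒥` falsifies that aggregate atom. -/
def Rule.Respects (σ : S.ProgSig) (M I : Set S.Atom) (𝒥 : Set (Set S.Atom)) (r : S.Rule) : Prop :=
  r.head ∈ I ∨ (∃ b ∈ r.neg, b ∈ M) ∨ (∃ b ∈ r.pos, b ∉ I) ∨ ∃ ℓ ∈ r.agg, ∃ J ∈ 𝒥, ¬ ℓ.Sat σ J

theorem Rule.Respects.mono {𝒥' : Set (Set S.Atom)} {r : S.Rule} (h : r.Respects σ M I 𝒥)
    (h𝒥 : 𝒥 ⊆ 𝒥') : r.Respects σ M I 𝒥' :=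
  h.imp_right <| Or.imp_right <| Or.imp_right fun ⟨ℓ, hℓ, J, hJ, hsat⟩ => ⟨ℓ, hℓ, J, h𝒥 hJ, hsat⟩

theorem Rule.Respects.exists_singleton {r : S.Rule} (h : r.Respects σ M I 𝒥) (h𝒥 : 𝒥.Nonempty) :
    ∃ J ∈ 𝒥, r.Respects σ M I {J} := by
  obtain ⟨J₀, hJ₀⟩ := h𝒥
  rcases h with h | h | h | ⟨ℓ, hℓ, J, hJ, hsat⟩
  · exact ⟨J₀, hJ₀, .inl h⟩
  · exact ⟨J₀, hJ₀, .inr (.inl h)⟩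
  · exact ⟨J₀, hJ₀, .inr (.inr (.inl h))⟩
  · exact ⟨J, hJ, .inr (.inr (.inr ⟨ℓ, hℓ, J, rfl, hsat⟩))⟩

namespace Program

variable (P : S.Program)

theorem K_subset_iff (hM : M ⊆ P.sig.base) (hI : I ⊆ M) :
    P.K M I ⊆ I ↔ ∀ r ∈ P.rules, r.Respects P.sig M I (Set.Icc I M) := by
  constructor
  · intro hK r hr
    by_contra hderiv
    simp only [Rule.Respects, not_or, not_exists, not_and, not_not] at hderiv
    obtain ⟨hhead, hneg, hpos, hagg⟩ := hderiv
    exact hhead (hK ⟨_, ⟨r, hr, hneg, rfl⟩, hpos,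
      fun ℓ hℓ => (AggAtom.condSat_iff hM hI).2 (hagg ℓ hℓ), rfl⟩)
  · rintro hresp a ⟨-, ⟨r, hr, hneg, rfl⟩, hpos, hagg, rfl⟩
    rcases hresp r hr with hhead | ⟨b, hb, hbM⟩ | ⟨b, hb, hbI⟩ | ⟨ℓ, hℓ, J, hJ, hsat⟩
    · exact hhead
    · exact absurd hbM (hneg b hb)
    · exact absurd (hpos b hb) hbI
    · exact absurd ((AggAtom.condSat_iff hM hI).1 (hagg ℓ hℓ) J hJ) hsat

theorem not_isFixpointAnswerSet_iff (hM : M ⊆ P.sig.base) :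
    ¬ P.IsFixpointAnswerSet M ↔ (∃ r ∈ P.rules, ¬ r.Respects P.sig M M {M}) ∨
      ∃ I ⊂ M, ∀ r ∈ P.rules, r.Respects P.sig M I (Set.Icc I M) := by
  rw [P.isFixpointAnswerSet_iff hM, not_and_or, P.K_subset_iff hM subset_rfl, Set.Icc_self]
  refine or_congr (by push Not; rfl) ?_
  push Not
  refine exists_congr fun I => ⟨fun ⟨hI, hK, hne⟩ => ?_, fun ⟨hI, hresp⟩ => ?_⟩
  · exact ⟨hI.ssubset_of_ne hne, (P.K_subset_iff hM hI).1 hK⟩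
  · exact ⟨hI.subset, (P.K_subset_iff hM hI.subset).2 hresp, hI.ne⟩

end Program

/-! ## Correctness of the verifier -/

theorem Atom.enc_injective : Function.Injective (Atom.enc (S := S)) := by
  rintro ⟨p, c⟩ ⟨p', c'⟩ h
  have hitems := congrArg items h
  simp only [Atom.enc, items_encWords, List.cons.injEq] at hitems
  obtain ⟨hpred, hargs⟩ := hitems
  obtain rfl := S.predName_injective hpred
  congr
  funext i
  exact S.constName_injective (congrFun (List.ofFn_injective hargs) i)

@[simp]
theorem items_encAtoms (l : List S.Atom) : items (encAtoms l) = l.map Atom.enc :=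
  items_encWords _

theorem Lists.enc_mem_map_iff {l : List S.Atom} (hl : Lists σ l M) (a : S.Atom) :
    a.enc ∈ l.map Atom.enc ↔ a ∈ M := by
  rw [List.mem_map_of_injective Atom.enc_injective, hl.2.2]

theorem Lists.exists_selectItems_eq {l : List S.Atom} (hl : Lists σ l M) (p : List Bool → Prop) :
    ∃ l', Lists σ l' {a ∈ M | p a.enc} ∧ selectItems p (encAtoms l) = encAtoms l' := by
  classical
  refine ⟨(l.filter fun a => p a.enc).reverse,
    ⟨fun a ha => hl.1 ha.1, List.nodup_reverse.mpr (hl.2.1.filter _), fun a => ?_⟩, ?_⟩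
  · simp [hl.2.2 a]
  · rw [selectItems, items_encAtoms, List.filter_map, ← List.map_reverse, encAtoms]
    congr!

/-- The oracle `A` tells whether the aggregate atoms in `𝒜` are true in an interpretation. -/
def Decides (A : Language Bool) (𝒜 : Set S.AggAtom) : Prop :=
  ∀ (σ : S.ProgSig) (ℓ : S.AggAtom), ℓ ∈ 𝒜 → ℓ.Over σ → ∀ (l : List S.Atom) (M : Set S.Atom),
    Lists σ l M → (encWords [ℓ.enc, encAtoms l] ∈ A ↔ ℓ.Sat σ M)

/-- The subset of the interpretation `M` that is listed by an arbitrary word `w`. -/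
def listedIn (M : Set S.Atom) (w : List Bool) : Set S.Atom :=
  {a ∈ M | a.enc ∈ items w}

variable {A : Language Bool} {𝒜 : Set S.AggAtom}

theorem respectsWord_enc_iff (hA : Decides A 𝒜) {r : S.Rule} (hr : r.Over σ)
    (hr𝒜 : ∀ ℓ ∈ r.agg, ℓ ∈ 𝒜) {l lI : List S.Atom} (hl : Lists σ l M) (hlI : Lists σ lI I)
    (hI : I ⊆ M) (js : List Bool) :
    RespectsWord A (encAtoms l) (encAtoms lI) js r.enc ↔
      r.Respects σ M I ((I ∪ listedIn M ·) '' {j | j ∈ items js}) := by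
  have hquery (ℓ) (hℓ : ℓ ∈ r.agg) (j : List Bool) :
      encWords [ℓ.enc, selectItems (fun a => a ∈ lI.map Atom.enc ∨ a ∈ items j)
        (encAtoms l)] ∈ A ↔ ℓ.Sat σ (I ∪ listedIn M j) := by
    obtain ⟨l', hl', heq⟩ := hl.exists_selectItems_eq
      fun a => a ∈ lI.map Atom.enc ∨ a ∈ items j
    have hset : {a ∈ M | a.enc ∈ lI.map Atom.enc ∨ a.enc ∈ items j} = I ∪ listedIn M j := by
      ext a
      have := @hI a
      simp only [hlI.enc_mem_map_iff, listedIn, Set.mem_union, Set.mem_ofPred_eq]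
      tauto
    rw [heq, hA σ ℓ (hr𝒜 ℓ hℓ) (hr.2.2.2 ℓ hℓ) l' _ hl', hset]
  have hex {α : Type} (f : α → List Bool) (l : List α) (p : List Bool → Prop) :
      (∃ b ∈ l.map f, p b) ↔ ∃ b ∈ l, p (f b) := by
    simp only [List.mem_map, exists_exists_and_eq_and]
  simp only [RespectsWord, Rule.Respects, Rule.enc, item_encWords, List.getD_cons_zero,
    List.getD_cons_succ, items_encWords, items_encAtoms, hex, hl.enc_mem_map_iff,
    hlI.enc_mem_map_iff, Set.exists_mem_image]
  refine or_congr_right (or_congr_right (or_congr_right (exists_congr fun ℓ =>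
    and_congr_right fun hℓ => exists_congr fun j => and_congr_right fun _ => ?_)))
  exact not_congr (hquery ℓ hℓ j)


theorem listedIn_subset (M : Set S.Atom) (w : List Bool) : listedIn M w ⊆ M :=
  fun _ ha => ha.1

open Classical in
theorem Lists.listedIn_filter {l : List S.Atom} (hl : Lists σ l M) (hI : I ⊆ M) :
    listedIn M (encAtoms (l.filter (· ∈ I))) = I := by
  ext a
  have := @hI a
  simp only [listedIn, items_encAtoms, List.mem_map_of_injective Atom.enc_injective,
    Set.mem_ofPred_eq, List.mem_filter, decide_eq_true_eq, hl.2.2]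
  tauto

theorem refutes_encWith_iff (hA : Decides A 𝒜) {P : S.Program} (hP : P.AggregatesIn 𝒜)
    {l : List S.Atom} (hl : Lists P.sig l M) (c : List Bool) :
    Refutes A (P.encWith l) c ↔ (∃ r ∈ P.rules, ¬ r.Respects P.sig M M {M}) ∨
      listedIn M (headItem c) ⊂ M ∧ ∀ r ∈ P.rules, r.Respects P.sig M (listedIn M (headItem c))
        ((listedIn M (headItem c) ∪ listedIn M ·) '' {j | j ∈ items (tailItems c)}) := by
  obtain ⟨lI, hlI, hselect⟩ : ∃ lI, Lists P.sig lI (listedIn M (headItem c)) ∧ _ :=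
    hl.exists_selectItems_eq (· ∈ items (headItem c))
  have hM : (M ∪ listedIn M ·) '' {j | j ∈ items (encWords [[]])} = {M} := by
    simp [Set.union_eq_self_of_subset_right (listedIn_subset M [])]
  have hproper : (∃ a ∈ items (encAtoms l), a ∉ items (headItem c)) ↔
      listedIn M (headItem c) ⊂ M := by
    rw [Set.ssubset_iff_exists, and_iff_right (listedIn_subset _ _)]
    simp only [items_encAtoms, List.mem_map, exists_exists_and_eq_and, hl.2.2, listedIn,
      Set.mem_ofPred_eq, not_and]
    exact exists_congr fun a => by tauto
  have hrespects (r) (hr : r ∈ P.rules) {I : Set S.Atom} {lI : List S.Atom}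
      (hlI : Lists P.sig lI I) (hI : I ⊆ M) (js : List Bool) :=
    respectsWord_enc_iff hA (P.rules_over r hr) (hP r hr) hl hlI hI js
  simp only [Refutes, Program.encWith, item_encWords, List.getD_cons_zero, List.getD_cons_succ,
    items_encWords, hselect, hproper, List.mem_map,
    exists_exists_and_eq_and, forall_exists_index, and_imp, forall_apply_eq_imp_iff₂]
  refine or_congr (exists_congr fun r => and_congr_right fun hr => ?_)
    (and_congr_right fun _ => forall₂_congr fun r hr => hrespects r hr hlI (listedIn_subset _ _) _)
  rw [hrespects r hr hl subset_rfl, hM]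

theorem not_isFixpointAnswerSet_of_refutes (hA : Decides A 𝒜) {P : S.Program}
    (hP : P.AggregatesIn 𝒜) {l : List S.Atom} (hl : Lists P.sig l M) {c : List Bool}
    (hc : Refutes A (P.encWith l) c) : ¬ P.IsFixpointAnswerSet M := by
  rw [P.not_isFixpointAnswerSet_iff hl.1]
  refine ((refutes_encWith_iff hA hP hl c).mp hc).imp_right fun ⟨hI, hresp⟩ =>
    ⟨_, hI, fun r hr => (hresp r hr).mono ?_⟩
  rintro - ⟨j, -, rfl⟩
  exact ⟨Set.subset_union_left, Set.union_subset hI.subset (listedIn_subset M j)⟩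

open Classical in
theorem exists_refutes (hA : Decides A 𝒜) {P : S.Program} (hP : P.AggregatesIn 𝒜)
    {l : List S.Atom} (hl : Lists P.sig l M) (hnot : ¬ P.IsFixpointAnswerSet M) :
    ∃ c : List Bool, c.length ≤ ((P.encWith l).length + 1) * (2 * (P.encWith l).length + 1) ∧
      Refutes A (P.encWith l) c := by
  simp only [refutes_encWith_iff hA hP hl]
  rcases (P.not_isFixpointAnswerSet_iff hl.1).mp hnot with hunclosed | ⟨I, hI, hresp⟩
  · exact ⟨[], Nat.zero_le _, .inl hunclosed⟩
  have hJ (r : S.Rule) : ∃ J ∈ Set.Icc I M, r ∈ P.rules → r.Respects P.sig M I {J} := by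
    by_cases hr : r ∈ P.rules
    · obtain ⟨J, hJ, hrJ⟩ := (hresp r hr).exists_singleton ⟨I, le_rfl, hI.subset⟩
      exact ⟨J, hJ, fun _ => hrJ⟩
    · exact ⟨I, ⟨le_rfl, hI.subset⟩, (absurd · hr)⟩
  choose J hJ hrJ using hJ
  let listing (X : Set S.Atom) : List Bool := encAtoms (l.filter (· ∈ X))
  have hlist {X : Set S.Atom} (hX : X ⊆ M) : listedIn M (listing X) = X := hl.listedIn_filter hX
  refine ⟨encWords (listing I :: P.rules.map fun r => listing (J r)), ?_, .inr ?_⟩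
  · refine (length_encWords_le (n := (P.encWith l).length) ?_).trans ?_
    · have hlen_le (X : Set S.Atom) : (listing X).length ≤ (P.encWith l).length :=
        (length_encWords_le_of_sublist (List.filter_sublist.map _)).trans
          (length_le_length_encWords_of_mem (by simp [encAtoms]))
      simp [hlen_le]
    · have hrules : P.rules.length ≤ (P.encWith l).length := by
        have := length_le_length_encWords (P.rules.map Rule.enc)
        rw [List.length_map] at this
        exact this.trans (length_le_length_encWords_of_mem (List.mem_cons_self ..))
      rw [List.length_cons, List.length_map]
      gcongr
  · simp only [encWords_cons, headItem_consItem, tailItems_consItem, items_encWords,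
      hlist hI.subset]
    refine ⟨hI, fun r hr => (hrJ r hr).mono ?_⟩
    rw [Set.singleton_subset_iff]
    refine ⟨listing (J r), List.mem_map.mpr ⟨r, hr, rfl⟩, ?_⟩
    simp only [hlist (hJ r).2, Set.union_eq_self_of_subset_left (hJ r).1]

end AspSignature

theorem mem_coNPClass_of_forall_notMem {C : Set (Language Bool)} {A V : Language Bool} (hA : A ∈ C)
    (hV : V ∈ PRel A) (q : Polynomial ℕ) :
    {w | ∀ y : List Bool, y.length ≤ q.eval w.length → encWords [w, y] ∉ V} ∈ CoNPClass C := by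
  refine ⟨{w | ∃ y : List Bool, y.length ≤ q.eval w.length ∧ encWords [w, y] ∈ V},
    ⟨A, hA, V, hV, q, fun w => Iff.rfl⟩, fun w => ?_⟩
  change (∀ y, _) ↔ ¬ ∃ y, _
  push Not
  rfl

/-- The answer set checking problem of `C`-decidable programs is in `co-NP^C`. -/
theorem mainTheorem8 (S : AspSignature) (C : Set (Language Bool)) (𝒜 : Set S.AggAtom)
    (h𝒜 : AspSignature.CDecidable C 𝒜) :
    ∃ L ∈ CoNPClass C, AspSignature.SolvesACP 𝒜 L := by
  obtain ⟨A, hAC, hA⟩ := h𝒜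
  let q : Polynomial ℕ := (.X + 1) * (2 * .X + 1)
  refine ⟨_, mem_coNPClass_of_forall_notMem hAC (mem_PRel_refutes A) q, fun P hP l M hl => ?_⟩
  have hmem (c : List Bool) : encWords [P.encWith l, c] ∈ {v | Refutes A (item 0 v) (item 1 v)} ↔
      Refutes A (P.encWith l) c := by
    simp [item_encWords, Set.mem_ofPred_eq]
  constructor
  · intro hno
    by_contra hnot
    obtain ⟨c, hlen, hc⟩ := AspSignature.exists_refutes hA hP hl hnot
    exact hno c (by simpa [q] using hlen) ((hmem c).mpr hc)
  · intro hM c _ hc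
    exact AspSignature.not_isFixpointAnswerSet_of_refutes hA hP hl ((hmem c).mp hc) hM
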